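/- Let $K$ be a field, $V=K^n$, and let $q\in K$, $q\ne 0$, be not a root of unity; put $k_q=(q^k-q^{-k})/(q-q^{-1})$. Let $R,F\in\mathrm{End}(V\otimes V)$ be a compatible pair, that is, on $V\otimes V\otimes V$ $$R_{12}R_{13}R_{23}=R_{23}R_{13}R_{12},\quad F_{12}F_{13}F_{23}=F_{23}F_{13}F_{12},\quad R_{12}F_{13}F_{23}=F_{23}F_{13}R_{12},\quad F_{12}F_{13}R_{23}=R_{23}F_{13}F_{12},$$ with $F$ invertible. Let $P$ be the flip of $V\otimes V$, $\hat R=PR$, $\hat F=PF$, and let $\hat R_k,\hat F_k$ denote these operators acting in the $k$-th and $(k+1)$-st factors of a tensor power of $V$. Assume that $\hat R$ is of Hecke type, $\hat R^2=(q-q^{-1})\hat R+I$, and that it has a skew inverse $\Psi\in\mathrm{End}(V\otimes V)$, i.e. $\mathrm{Tr}_{(2)}(\Psi_{12}\hat R_{23})=P_{13}=\mathrm{Tr}_{(2)}(\hat R_{12}\Psi_{23})$. Put $D=\mathrm{Tr}_{(2)}\Psi_{12}\in\mathrm{End}(V)$ and let $\mathrm{Tr}_{\hat R}(Z)=\mathrm{Tr}(DZ)$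 be the quantum trace; $\mathrm{Tr}_{\hat R(a\dots k)}$ is the quantum trace over the factors $a,\dots,k$ of $V^{\otimes k}$. Define $A^{(1)}=S^{(1)}=I$ and, for $k\ge 2$, $$A^{(k)}=\tfrac1{k_q}A^{(k-1)}\bigl(q^{k-1}-(k-1)_q\hat R_{k-1}\bigr)A^{(k-1)},\qquad S^{(k)}=\tfrac1{k_q}S^{(k-1)}\bigl(q^{1-k}+(k-1)_q\hat R_{k-1}\bigr)S^{(k-1)}.$$ Let $\mathcal M(\hat R,\hat F)$ be the unital associative $K$-algebra with generators $M^i_j$ $(1\le i,j\le n)$ and defining relations $$\hat R\,M_1\hat F M_1\hat F^{-1}=M_1\hat F M_1\hat F^{-1}\hat R ,$$ where $M=(M^i_j)$ and $M_1=M\otimes I$. Put $M_{\overline 1}=M_1$, $M_{\overline{k+1}}=\hat F_kM_{\overline k}\hat F_k^{-1}$. For $k\ge1$ define the $n\times n$ matrices $$M^{\overline k}=\mathrm{Tr}_{\hat R(2\dots k)}(\hat R_1\cdots\hat R_{k-1}M_{\overline1}\cdots M_{\overline k}),\quad M^{\wedge k}=\mathrm{Tr}_{\hat R(2\dots k)}(A^{(k)}M_{\overline1}\cdots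 M_{\overline k}),\quad M^{\mathcal Sk}=\mathrm{Tr}_{\hat R(2\dots k)}(S^{(k)}M_{\overline1}\cdots M_{\overline k})$$ over $\mathcal M(\hat R,\hat F)$ and the elements $$\sigma_k(M)=q^k\,\mathrm{Tr}_{\hat R(1\dots k)}(A^{(k)}M_{\overline1}\cdots M_{\overline k}),\qquad \tau_k(M)=q^{-k}\,\mathrm{Tr}_{\hat R(1\dots k)}(S^{(k)}M_{\overline1}\cdots M_{\overline k})$$ of $\mathcal M(\hat R,\hat F)$, and put $\sigma_0(M)=\tau_0(M)=1$. Then for every $i\ge1$ $$i_q\,M^{\wedge i}=\sum_{k=0}^{i-1}(-1)^{i-k+1}M^{\overline{i-k}}\,\sigma_k(M),\qquad i_q\,M^{\mathcal Si}=\sum_{k=0}^{i-1}M^{\overline{i-k}}\,\tau_k(M),$$ and the elements $\sigma_k(M),\tau_k(M)$, $k\ge0$, generate a commutative subalgebra of $\mathcal M(\hat R,\hat F)$. -/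

import Mathlib

open Matrix

noncomputable section

namespace QMatrix

variable {K : Type*} [Field K] {n : ℕ}

/-- Operators on `V ⊗ V`, `V = K ^ n`, with entries in `S`; rows are upper indices. -/
abbrev Mat2 (n : ℕ) (S : Type*) := Matrix (Fin n × Fin n) (Fin n × Fin n) S

/-- Operators on `V ^ ⊗ m`, `V = K ^ n`, with entries in `S`.
The tensor factors are numbered `0, …, m - 1`. -/
abbrev MatT (m n : ℕ) (S : Type*) := Matrix (Fin m → Fin n) (Fin m → Fin n) S

/-- The permutation `P` of the two factors of `V ⊗ V`. -/
def perm (n : ℕ) (K : Type*) [Field K] : Mat2 n K :=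
  Matrix.of fun x y => if x = y.swap then 1 else 0

/-- The operator `Z` acting in the tensor factor `a`, identity in the others. -/
def leg1 {S : Type*} [Zero S] {m : ℕ} (a : Fin m) (Z : Matrix (Fin n) (Fin n) S) : MatT m n S :=
  Matrix.of fun I J => if ∀ c, c ≠ a → I c = J c then Z (I a) (J a) else 0

/-- The operator `X` acting in the tensor factors `a`, `b` (in this order; `a ≠ b`),
identity in the others. -/
def leg2 {S : Type*} [Zero S] {m : ℕ} (a b : Fin m) (X : Mat2 n S) : MatT m n S :=
  Matrix.of fun I J =>
    if ∀ c, c ≠ a → c ≠ b → I c = J c then X (I a, I b) (J a, J b) else 0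

/-- The operator `X` acting in the neighbouring factors `j`, `j + 1` of `V ^ ⊗ m`.
It is only used for `j + 1 < m`. -/
def adj {S : Type*} [Zero S] [One S] (m : ℕ) (X : Mat2 n S) (j : ℕ) : MatT m n S :=
  if h : j + 1 < m then leg2 ⟨j, Nat.lt_of_succ_lt h⟩ ⟨j + 1, h⟩ X else 1

/-- Compatible pairs of numerical matrices. -/
structure Compatible (R F : Mat2 n K) : Prop where
  ybR : (leg2 0 1 R * leg2 0 2 R * leg2 1 2 R : MatT 3 n K)
    = leg2 1 2 R * leg2 0 2 R * leg2 0 1 R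
  ybF : (leg2 0 1 F * leg2 0 2 F * leg2 1 2 F : MatT 3 n K)
    = leg2 1 2 F * leg2 0 2 F * leg2 0 1 F
  twist₁ : (leg2 0 1 R * leg2 0 2 F * leg2 1 2 F : MatT 3 n K)
    = leg2 1 2 F * leg2 0 2 F * leg2 0 1 R
  twist₂ : (leg2 0 1 F * leg2 0 2 F * leg2 1 2 R : MatT 3 n K)
    = leg2 1 2 R * leg2 0 2 F * leg2 0 1 F

/-- The operator `P R` (written with a hat). -/
def hat (R : Mat2 n K) : Mat2 n K := perm n K * R

/-- The trace over the middle factor of `V ⊗ V ⊗ V`. -/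
def traceMid (Z : MatT 3 n K) : Mat2 n K :=
  Matrix.of fun x y => ∑ s, Z ![x.1, s, x.2] ![y.1, s, y.2]

/-- `Ψ` is the skew inverse of `X`:
`Tr₂ (Ψ₁₂ X₂₃) = P₁₃ = Tr₂ (X₁₂ Ψ₂₃)`. -/
structure IsSkewInverse (X Ψ : Mat2 n K) : Prop where
  left : traceMid (leg2 0 1 Ψ * leg2 1 2 X) = perm n K
  right : traceMid (leg2 0 1 X * leg2 1 2 Ψ) = perm n K

/-- `D = Tr₂ Ψ₁₂`. -/
def traceSnd (Ψ : Mat2 n K) : Matrix (Fin n) (Fin n) K :=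
  Matrix.of fun a b => ∑ c, Ψ (a, c) (b, c)

/-- `k_q = (q ^ k - q ^ (-k)) / (q - q ^ (-1))`. -/
def qInt (q : K) (k : ℕ) : K := (q ^ k - q⁻¹ ^ k) / (q - q⁻¹)

/-- The `q`-antisymmetrizer of the first `k` factors of `V ^ ⊗ m` (`k ≤ m`),
`X` being the Hecke operator on `V ⊗ V`. -/
def qAntisym (q : K) (X : Mat2 n K) (m : ℕ) : ℕ → MatT m n K
  | 0 => 1
  | 1 => 1
  | k + 2 => (qInt q (k + 2))⁻¹ •
      (qAntisym q X m (k + 1) * (q ^ (k + 1) • 1 - qInt q (k + 1) • adj m X k)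
        * qAntisym q X m (k + 1))

/-- The `q`-symmetrizer of the first `k` factors of `V ^ ⊗ m` (`k ≤ m`). -/
def qSym (q : K) (X : Mat2 n K) (m : ℕ) : ℕ → MatT m n K
  | 0 => 1
  | 1 => 1
  | k + 2 => (qInt q (k + 2))⁻¹ •
      (qSym q X m (k + 1) * (q⁻¹ ^ (k + 1) • 1 + qInt q (k + 1) • adj m X k)
        * qSym q X m (k + 1))

/-- The product of `X` in the factors `(0,1)`, `(1,2)`, …, `(m-2,m-1)` of `V ^ ⊗ m`,
in this order. -/
def adjProd (X : Mat2 n K) (m : ℕ) : MatT m n K :=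
  ((List.range (m - 1)).map (adj m X)).prod

section Powers

variable {S : Type*} [Ring S] [Algebra K S]

/-- A numerical matrix regarded as a matrix over the `K`-algebra `S`. -/
def num (S : Type*) [Ring S] [Algebra K S] {ι : Type*} (Z : Matrix ι ι K) : Matrix ι ι S :=
  Z.map (algebraMap K S)

/-- The copies of `M` in `V ^ ⊗ (p + 1)`: first `M` in factor `0`, then
repeated conjugation by `X = F̂` in the factors `j`, `j + 1`. -/
def copy (X : Mat2 n K) (M : Matrix (Fin n) (Fin n) S) (p : ℕ) : ℕ → MatT (p + 1) n S
  | 0 => leg1 0 M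
  | j + 1 => num S (adj (p + 1) X j) * copy X M p j * num S (adj (p + 1) X⁻¹ j)

/-- The ordered product of the `p + 1` copies of `M` in `V ^ ⊗ (p + 1)`. -/
def copyProd (X : Mat2 n K) (M : Matrix (Fin n) (Fin n) S) (p : ℕ) : MatT (p + 1) n S :=
  ((List.range (p + 1)).map (copy X M p)).prod

/-- The quantum trace `Tr (D ⊗ ⋯ ⊗ D · Z)` over all factors. -/
def qTrace (D : Matrix (Fin n) (Fin n) K) {m : ℕ} (Z : MatT m n S) : S :=
  ∑ s : Fin m → Fin n, ∑ t : Fin m → Fin n, (∏ c, D (s c) (t c)) • Z t s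

/-- The quantum trace `Tr (1 ⊗ D ⊗ ⋯ ⊗ D · Z)` over all factors but the first. -/
def qTraceTail (D : Matrix (Fin n) (Fin n) K) {p : ℕ} (Z : MatT (p + 1) n S) :
    Matrix (Fin n) (Fin n) S :=
  Matrix.of fun a b => ∑ s : Fin p → Fin n, ∑ t : Fin p → Fin n,
    (∏ c, D (s c) (t c)) • Z (vecCons a t) (vecCons b s)

/-- The generalized `k`-th power of `M`, for `k ≥ 1`. Here `X = R̂`, `Y = F̂`. -/
def qPow (D : Matrix (Fin n) (Fin n) K) (X Y : Mat2 n K)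
    (M : Matrix (Fin n) (Fin n) S) : ℕ → Matrix (Fin n) (Fin n) S
  | 0 => 0
  | p + 1 => qTraceTail D (num S (adjProd X (p + 1)) * copyProd Y M p)

/-- The `k`-wedge power of `M`, for `k ≥ 1`. -/
def wedgePow (q : K) (D : Matrix (Fin n) (Fin n) K) (X Y : Mat2 n K)
    (M : Matrix (Fin n) (Fin n) S) : ℕ → Matrix (Fin n) (Fin n) S
  | 0 => 0
  | p + 1 => qTraceTail D (num S (qAntisym q X (p + 1) (p + 1)) * copyProd Y M p)

/-- The `k`-symmetric power of `M`, for `k ≥ 1`. -/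
def symPow (q : K) (D : Matrix (Fin n) (Fin n) K) (X Y : Mat2 n K)
    (M : Matrix (Fin n) (Fin n) S) : ℕ → Matrix (Fin n) (Fin n) S
  | 0 => 0
  | p + 1 => qTraceTail D (num S (qSym q X (p + 1) (p + 1)) * copyProd Y M p)

/-- The elementary symmetric functions `σ_k (M)`. -/
def sigma (q : K) (D : Matrix (Fin n) (Fin n) K) (X Y : Mat2 n K)
    (M : Matrix (Fin n) (Fin n) S) : ℕ → S
  | 0 => 1
  | p + 1 => q ^ (p + 1) •
      qTrace D (num S (qAntisym q X (p + 1) (p + 1)) * copyProd Y M p)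

/-- The complete symmetric functions `τ_k (M)`. -/
def tau (q : K) (D : Matrix (Fin n) (Fin n) K) (X Y : Mat2 n K)
    (M : Matrix (Fin n) (Fin n) S) : ℕ → S
  | 0 => 1
  | p + 1 => q⁻¹ ^ (p + 1) •
      qTrace D (num S (qSym q X (p + 1) (p + 1)) * copyProd Y M p)

end Powers

/-- The generic matrix over the free algebra on `n × n` generators. -/
def freeGen (n : ℕ) (K : Type*) [Field K] :
    Matrix (Fin n) (Fin n) (FreeAlgebra K (Fin n × Fin n)) :=
  Matrix.of fun i j => FreeAlgebra.ι K (i, j)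

/-- `M₁ Y M₁ Y⁻¹` on `V ⊗ V`. -/
def quad {S : Type*} [Ring S] [Algebra K S] (Y : Mat2 n K) (M : Matrix (Fin n) (Fin n) S) :
    MatT 2 n S :=
  leg1 0 M * num S (leg2 0 1 Y) * leg1 0 M * num S (leg2 0 1 Y⁻¹)

/-- The defining relations `X M₁ Y M₁ Y⁻¹ = M₁ Y M₁ Y⁻¹ X`, entry by entry. -/
inductive Rel (X Y : Mat2 n K) :
    FreeAlgebra K (Fin n × Fin n) → FreeAlgebra K (Fin n × Fin n) → Prop
  | entry (I J : Fin 2 → Fin n) :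
      Rel X Y
        ((num (FreeAlgebra K (Fin n × Fin n)) (leg2 0 1 X) * quad Y (freeGen n K) :
          MatT 2 n _) I J)
        ((quad Y (freeGen n K) * num (FreeAlgebra K (Fin n × Fin n)) (leg2 0 1 X) :
          MatT 2 n _) I J)

/-- The quantum matrix algebra with generators `M i j` and the above defining relations
(`X = R̂`, `Y = F̂`). -/
abbrev QMAlg (X Y : Mat2 n K) : Type _ := RingQuot (Rel X Y)

/-- The matrix of generators of the quantum matrix algebra. -/
def gen (X Y : Mat2 n K) : Matrix (Fin n) (Fin n) (QMAlg X Y) :=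
  (freeGen n K).map (RingQuot.mkAlgHom K (Rel X Y))

end QMatrix

end

/-! On `V ^ ⊗ N` the operators `R̂_j` satisfy the Hecke relations, and `A^(k)` is an idempotent that
absorbs each of its generators with eigenvalue `-q⁻¹` (`antisym_mul_gen`). Absorption determines it,
so it can also be built by adding a strand on the left (`antisym_succ_left`).

Three facts connect this with the quantum matrix. The product of the copies of `M` commutes with the
generators (`T_commute_prodFrom`). The quantum trace over a block of factors is cyclic for the
generators inside the block (`multiTr_cyc_gen`). The quantum trace is invariant under conjugation by
`F̂` (`ptr_conj_unitAt`), so `σ_k` may be computed at any position in the chain. Hence an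
antisymmetrizer on the last `l` factors splits off as a right factor `σ_l`, up to a power of `q`
(`multiTr_factor`).

For the Newton identities, let `B` be the antisymmetrizer on the last `k + 1` of `m + k + 2`
factors. In the trace of `R̂_1 ⋯ R̂_m A^(k+2)`, with `A^(k+2)` on the last `k + 2` factors,
substitute `[k+2] A^(k+2) = B (q^(k+1) - [k+1] R̂_(m+1)) B`. One `B` is carried round the trace and
merges with the other. The first term is then the `(m+1)`-st power of `M` times `σ_(k+1)`; the
second is `-[k+1]` times the same kind of trace with `k` lowered by one. The recursion telescopes
(`multiTr_newton`).

For commutativity, `σ_k σ_l` is up to a scalar the trace of two antisymmetrizers side by side. A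
power of the Coxeter element `R̂_1 ⋯ R̂_(k+l-1)` exchanges the two blocks, commutes with the copies
of `M` and can be moved round the trace (`multiTr_antisym_commute`).

The trace properties come from the skew inverse: the quantum trace of `R̂` over its second factor is
`1`, and the coefficients of `R̂` in the first factor span `End V` in the second
(`e_eq_sum_coeffAt`). The symmetric statements follow from the substitution `q ↦ -q⁻¹`, which
preserves the Hecke relation. -/

noncomputable section

namespace QMatrix

/-! ### Antisymmetrizers and Coxeter elements in Hecke algebras. -/

section Hecke

variable {K : Type*} [Field K] {E : Type*} [Ring E] [Algebra K E]

/-- The `q`-antisymmetrizer built from a sequence `T` of elements of an algebra. -/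
def antisym (q : K) (T : ℕ → E) : ℕ → E
  | 0 => 1
  | 1 => 1
  | k + 2 => (qInt q (k + 2))⁻¹ •
      (antisym q T (k + 1) * (q ^ (k + 1) • 1 - qInt q (k + 1) • T k) * antisym q T (k + 1))

/-- `T 0, …, T (r - 1)` satisfy the relations of the Hecke algebra. -/
structure IsHecke (q : K) (T : ℕ → E) (r : ℕ) : Prop where
  quad : ∀ i, i < r → T i * T i = (q - q⁻¹) • T i + 1
  braid : ∀ i, i + 1 < r → T i * T (i + 1) * T i = T (i + 1) * T i * T (i + 1)
  comm : ∀ i j, i + 1 < j → j < r → Commute (T i) (T j)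

lemma antisym_mem (q : K) (T : ℕ → E) (W : Subalgebra K E) :
    ∀ k : ℕ, (∀ i, i + 1 < k → T i ∈ W) → antisym q T k ∈ W
  | 0, _ => W.one_mem
  | 1, _ => W.one_mem
  | k + 2, h => by
    have ih := antisym_mem q T W (k + 1) fun i hi => h i (by omega)
    exact W.smul_mem (W.mul_mem (W.mul_mem ih (W.sub_mem (W.smul_mem W.one_mem _)
      (W.smul_mem (h k (by omega)) _))) ih) _

lemma semiconjBy_smul {g x y : E} (h : SemiconjBy g x y) (c : K) :
    SemiconjBy g (c • x) (c • y) := by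
  unfold SemiconjBy at *
  rw [mul_smul_comm, smul_mul_assoc, h]

lemma antisym_semiconjBy (q : K) {T T' : ℕ → E} {g : E} :
    ∀ k : ℕ, (∀ i, i + 1 < k → SemiconjBy g (T i) (T' i)) →
      SemiconjBy g (antisym q T k) (antisym q T' k)
  | 0, _ => SemiconjBy.one_right g
  | 1, _ => SemiconjBy.one_right g
  | k + 2, h => by
    have ih := antisym_semiconjBy q (k + 1) fun i hi => h i (by omega)
    exact semiconjBy_smul ((ih.mul_right ((semiconjBy_smul (SemiconjBy.one_right g) _).sub_right
      (semiconjBy_smul (h k (by omega)) _))).mul_right ih) _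

lemma antisym_map {E' : Type*} [Ring E'] [Algebra K E'] (φ : E →ₐ[K] E') (q : K) {T : ℕ → E}
    {T' : ℕ → E'} :
    ∀ k : ℕ, (∀ i, i + 1 < k → φ (T i) = T' i) → φ (antisym q T k) = antisym q T' k
  | 0, _ => map_one φ
  | 1, _ => map_one φ
  | k + 2, h => by
    have ih := antisym_map φ q (k + 1) fun i hi => h i (by omega)
    simp only [antisym, map_smul, map_mul, map_sub, map_one, ih, h k (by omega)]

lemma qInt_ne_zero {q : K} (hq0 : q ≠ 0) (hq : ∀ m : ℕ, 0 < m → q ^ m ≠ 1) {k : ℕ} (hk : 0 < k) :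
    qInt q k ≠ 0 := by
  have key : ∀ m : ℕ, 0 < m → q ^ m - q⁻¹ ^ m ≠ 0 := by
    intro m hm h
    apply hq (2 * m) (by omega)
    have h1 : q ^ m = q⁻¹ ^ m := sub_eq_zero.mp h
    rw [two_mul, pow_add]
    nth_rewrite 2 [h1]
    rw [← mul_pow, mul_inv_cancel₀ hq0, one_pow]
  have h1 := key 1 one_pos
  rw [pow_one, pow_one] at h1
  exact div_ne_zero (key k hk) h1

lemma qInt_succ {q : K} (hq0 : q ≠ 0) (hq : q - q⁻¹ ≠ 0) (k : ℕ) :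
    qInt q (k + 1) = q ^ k + q⁻¹ * qInt q k := by
  unfold qInt
  rw [eq_comm, ← mul_div_assoc, eq_div_iff hq, add_mul, div_mul_cancel₀ _ hq, pow_succ, pow_succ]
  have : q * q⁻¹ = 1 := mul_inv_cancel₀ hq0
  ring

lemma qInt_one {q : K} (hq : q - q⁻¹ ≠ 0) : qInt q 1 = 1 := by simp [qInt, hq]

/-- Nondegeneracy of the parameter: `q` is neither zero nor a root of unity. -/
structure Generic (q : K) : Prop where
  ne_zero : q ≠ 0
  pow_ne_one : ∀ m : ℕ, 0 < m → q ^ m ≠ 1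

lemma Generic.qInt_ne {q : K} (h : Generic q) {k : ℕ} (hk : 0 < k) : qInt q k ≠ 0 :=
  qInt_ne_zero h.1 h.2 hk

lemma Generic.sub_inv_ne {q : K} (h : Generic q) : q - q⁻¹ ≠ 0 := by
  intro h0
  apply h.pow_ne_one 2 two_pos
  rw [sub_eq_zero] at h0
  rw [pow_two]
  nth_rewrite 2 [h0]
  exact mul_inv_cancel₀ h.1

/-- On an eigenvector with eigenvalue `-q⁻¹` the middle bracket of the recursion acts by `q ^ (k+1)
+ q⁻¹ [k+1] = [k+2]`, which the prefactor cancels. -/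
lemma mul_antisym_of_absorb {q : K} (hq : Generic q) (T : ℕ → E) (e : E) :
    ∀ k : ℕ, (∀ i, i + 1 < k → e * T i = -(q⁻¹ • e)) → e * antisym q T k = e
  | 0, _ => mul_one e
  | 1, _ => mul_one e
  | k + 2, h => by
    have ih := mul_antisym_of_absorb hq T e (k + 1) fun i hi => h i (by omega)
    rw [antisym, mul_smul_comm, ← mul_assoc, ← mul_assoc, ih, mul_sub, mul_smul_comm,
      mul_smul_comm, mul_one, h k (by omega), smul_neg, sub_neg_eq_add, smul_smul, ← add_smul,
      smul_mul_assoc, ih, smul_smul, mul_comm (qInt q (k + 1)),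
      ← qInt_succ hq.ne_zero hq.sub_inv_ne, inv_mul_cancel₀ (hq.qInt_ne (by omega)), one_smul]

/-- By the form of the recursion only the last generator is new. For it the right-hand
antisymmetrizer is unfolded once, after which the quadratic and braid relations suffice. -/
lemma antisym_mul_gen {q : K} (hq : Generic q) {T : ℕ → E} {r : ℕ} (hT : IsHecke q T r) :
    ∀ k : ℕ, k ≤ r + 1 → ∀ i, i + 1 < k → antisym q T k * T i = -(q⁻¹ • antisym q T k)
  | 0, _, _, hi => by omega
  | 1, _, _, hi => by omega
  | 2, hk, i, hi => by
    obtain rfl : i = 0 := by omega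
    have hq1 : q * q⁻¹ = 1 := mul_inv_cancel₀ hq.ne_zero
    simp only [antisym, one_mul, mul_one, smul_mul_assoc, sub_mul, hT.quad 0 (by omega), zero_add,
      qInt_one hq.sub_inv_ne, one_smul, pow_one]
    match_scalars
    · ring_nf
    · linear_combination (qInt q 2)⁻¹ * hq1
  | k + 3, hk, i, hi => by
    have ih := antisym_mul_gen hq hT (k + 2) (by omega)
    by_cases hik : i + 1 < k + 2
    · rw [antisym, smul_mul_assoc, mul_assoc, ih i hik]
      simp only [mul_neg, mul_smul_comm, smul_neg]
      rw [smul_comm]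
    obtain rfl : i = k + 1 := by omega
    set A := antisym q T (k + 1) with hA
    set A' := antisym q T (k + 2) with hA'
    have hA'A : A' * A = A' := mul_antisym_of_absorb hq T A' (k + 1) fun i hi => ih i (by omega)
    have hcomm : Commute (T (k + 1)) A :=
      antisym_semiconjBy q (k + 1) fun i hi => (hT.comm i (k + 1) (by omega) (by omega)).symm
    have hk2 := hq.qInt_ne (show 0 < k + 2 by omega)
    -- Unfold the right `A'`; its left factor `A` commutes with `T (k + 1)` and is absorbed by the
    -- left `A'`.
    have h1 : qInt q (k + 2) • (A' * T (k + 1) * A')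
        = A' * (q ^ (k + 1) • T (k + 1) - qInt q (k + 1) • (T (k + 1) * T k)) * A := by
      have : qInt q (k + 2) • A' = A * (q ^ (k + 1) • 1 - qInt q (k + 1) • T k) * A := by
        rw [hA', antisym, smul_smul, mul_inv_cancel₀ hk2, one_smul]
      rw [← mul_smul_comm, this, ← mul_assoc, ← mul_assoc, mul_assoc A', hcomm.eq, ← mul_assoc A',
        hA'A]
      simp only [mul_sub, mul_smul_comm, mul_one, mul_assoc]
    have h2 : A' * (q ^ (k + 2) • 1 - qInt q (k + 2) • T (k + 1)) * A'
        = A' * (q ^ (k + 2) • 1 - q ^ (k + 1) • T (k + 1)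
            + qInt q (k + 1) • (T (k + 1) * T k)) * A := by
      have hAA : A' * A' = A' * A := by
        rw [hA'A]; exact mul_antisym_of_absorb hq T A' (k + 2) ih
      rw [mul_sub, sub_mul, mul_smul_comm _ A' (T (k + 1)), smul_mul_assoc _ (A' * T (k + 1)), h1,
        mul_smul_comm, mul_one, smul_mul_assoc, hAA]
      simp only [mul_sub, mul_add, sub_mul, add_mul, mul_smul_comm, smul_mul_assoc, mul_one]
      abel
    -- The braid relation brings a `T k` next to `A'`, where the induction hypothesis absorbs it.
    have h3 : A' * T (k + 1) * T k * T (k + 1) = -(q⁻¹ • (A' * T (k + 1) * T k)) := by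
      have hb := hT.braid k (by omega)
      rw [mul_assoc, mul_assoc, ← mul_assoc (T (k + 1)), ← hb, ← mul_assoc, ← mul_assoc,
        ih k (by omega)]
      simp only [neg_mul, smul_mul_assoc]
    have hq1 : q * q⁻¹ = 1 := mul_inv_cancel₀ hq.ne_zero
    rw [antisym, ← hA', h2, smul_mul_assoc, mul_assoc _ A, ← hcomm.eq, ← mul_assoc]
    rw [smul_comm, ← smul_neg, ← smul_mul_assoc q⁻¹, ← neg_mul]
    congr 2
    simp only [mul_sub, mul_add, sub_mul, add_mul, mul_smul_comm, smul_mul_assoc, mul_one,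
      ← mul_assoc, h3]
    rw [mul_assoc A' (T (k + 1)) (T (k + 1)), hT.quad (k + 1) (by omega)]
    simp only [mul_add, mul_smul_comm, mul_one]
    match_scalars
    · ring
    · linear_combination q * q ^ k * hq1
    · ring

lemma IsHecke.mono {q : K} {T : ℕ → E} {r r' : ℕ} (hT : IsHecke q T r) (h : r' ≤ r) :
    IsHecke q T r' where
  quad i hi := hT.quad i (by omega)
  braid i hi := hT.braid i (by omega)
  comm i j hij hj := hT.comm i j hij (by omega)

lemma IsHecke.shift {q : K} {T : ℕ → E} {r s : ℕ} (hT : IsHecke q T r) (j : ℕ) (h : j + s ≤ r) :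
    IsHecke q (fun i => T (j + i)) s where
  quad i hi := hT.quad (j + i) (by omega)
  braid i hi := hT.braid (j + i) (by omega)
  comm i i' hij hj := hT.comm (j + i) (j + i') (by omega) (by omega)

lemma IsHecke.reverse {q : K} {T : ℕ → E} {r : ℕ} (hT : IsHecke q T (r + 1)) :
    IsHecke q (fun i => T (r - i)) (r + 1) where
  quad i hi := hT.quad (r - i) (by omega)
  braid i hi := by
    have h := hT.braid (r - (i + 1)) (by omega)
    rw [show r - (i + 1) + 1 = r - i by omega] at h
    exact h.symm
  comm i j hij hj := (hT.comm (r - j) (r - i) (by omega) (by omega)).symm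

lemma IsHecke.op {q : K} {T : ℕ → E} {r : ℕ} (hT : IsHecke q T r) :
    IsHecke q (fun i => MulOpposite.op (T i)) r where
  quad i hi := by
    rw [← MulOpposite.op_mul, hT.quad i hi, MulOpposite.op_add, MulOpposite.op_smul,
      MulOpposite.op_one]
  braid i hi := by
    simp only [← MulOpposite.op_mul, ← mul_assoc]
    rw [hT.braid i hi]
  comm i j hij hj := by
    rw [Commute, SemiconjBy, ← MulOpposite.op_mul, ← MulOpposite.op_mul, (hT.comm i j hij hj).eq]

/-- The recursion is a palindrome, so statements about right multiplication transfer to left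
multiplication through the opposite algebra. -/
lemma antisym_op (q : K) (T : ℕ → E) :
    ∀ k, antisym q (fun i => MulOpposite.op (T i)) k = MulOpposite.op (antisym q T k)
  | 0 => rfl
  | 1 => rfl
  | k + 2 => by
    rw [antisym, antisym, antisym_op q T (k + 1)]
    simp only [MulOpposite.op_smul, MulOpposite.op_mul, MulOpposite.op_sub, MulOpposite.op_one,
      mul_assoc]

lemma gen_mul_antisym {q : K} (hq : Generic q) {T : ℕ → E} {r : ℕ} (hT : IsHecke q T r) (k : ℕ)
    (hk : k ≤ r + 1) (i : ℕ) (hi : i + 1 < k) :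
    T i * antisym q T k = -(q⁻¹ • antisym q T k) := by
  have h := antisym_mul_gen hq hT.op k hk i hi
  rw [antisym_op, ← MulOpposite.op_mul, ← MulOpposite.op_smul, ← MulOpposite.op_neg] at h
  exact MulOpposite.op_injective h

lemma antisym_mul_of_absorb {q : K} (hq : Generic q) (T : ℕ → E) (e : E) (k : ℕ)
    (h : ∀ i, i + 1 < k → T i * e = -(q⁻¹ • e)) : antisym q T k * e = e := by
  have h := mul_antisym_of_absorb hq (fun i => MulOpposite.op (T i)) (MulOpposite.op e) k
    fun i hi => by rw [← MulOpposite.op_mul, h i hi, MulOpposite.op_neg, MulOpposite.op_smul]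
  rw [antisym_op, ← MulOpposite.op_mul] at h
  exact MulOpposite.op_injective h

lemma antisym_mul_self {q : K} (hq : Generic q) {T : ℕ → E} {r : ℕ} (hT : IsHecke q T r) (k : ℕ)
    (hk : k ≤ r + 1) : antisym q T k * antisym q T k = antisym q T k :=
  mul_antisym_of_absorb hq T _ k (antisym_mul_gen hq hT k hk)

/-- Both elements absorb all generators on both sides, hence they absorb each other: their product
equals either one. -/
lemma antisym_eq_reverse {q : K} (hq : Generic q) {T : ℕ → E} {r : ℕ}
    (hT : IsHecke q T (r + 1)) :
    antisym q (fun i => T (r - i)) (r + 2) = antisym q T (r + 2) := by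
  have h1 : antisym q (fun i => T (r - i)) (r + 2) * antisym q T (r + 2)
      = antisym q (fun i => T (r - i)) (r + 2) := by
    refine mul_antisym_of_absorb hq T _ _ fun i hi => ?_
    have := antisym_mul_gen hq hT.reverse (r + 2) (by omega) (r - i) (by omega)
    rwa [show r - (r - i) = i by omega] at this
  have h2 : antisym q (fun i => T (r - i)) (r + 2) * antisym q T (r + 2)
      = antisym q T (r + 2) :=
    antisym_mul_of_absorb hq _ _ _ fun i hi =>
      gen_mul_antisym hq hT (r + 2) (by omega) (r - i) (by omega)
  exact h1.symm.trans h2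

/-- The recursion for the antisymmetrizer that adds a factor on the left. -/
lemma antisym_succ_left {q : K} (hq : Generic q) {T : ℕ → E} {r : ℕ}
    (hT : IsHecke q T (r + 1)) :
    qInt q (r + 2) • antisym q T (r + 2)
      = antisym q (fun i => T (1 + i)) (r + 1) * (q ^ (r + 1) • 1 - qInt q (r + 1) • T 0)
        * antisym q (fun i => T (1 + i)) (r + 1) := by
  -- Both sides use the generators `T 1, …, T r`, listed in opposite orders.
  have key : antisym q (fun i => T (r - i)) (r + 1) = antisym q (fun i => T (1 + i)) (r + 1) := by
    rcases r with _ | r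
    · rfl
    rw [← antisym_eq_reverse hq (hT.shift 1 (show 1 + (r + 1) ≤ r + 1 + 1 by omega))]
    have : ∀ k ≤ r + 2, antisym q (fun i => T (r + 1 - i)) k
        = antisym q (fun i => T (1 + (r - i))) k := fun k hk =>
      antisym_map (AlgHom.id K E) q k fun i hi => by
        rw [AlgHom.id_apply, show r + 1 - i = 1 + (r - i) by omega]
    exact this _ le_rfl
  -- In the reversed order the generator added last is `T (r - r) = T 0`.
  rw [← antisym_eq_reverse hq hT, antisym, key, smul_smul,
    mul_inv_cancel₀ (hq.qInt_ne (by omega)), one_smul, Nat.sub_self]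

/-- The product `T 0 * T 1 * ⋯ * T (r - 1)`. -/
def coxeter (T : ℕ → E) (r : ℕ) : E := ((List.range r).map T).prod

lemma coxeter_succ (T : ℕ → E) (r : ℕ) : coxeter T (r + 1) = coxeter T r * T r := by
  simp [coxeter, List.range_succ]

lemma coxeter_mem (T : ℕ → E) (r : ℕ) (W : Subalgebra K E) (h : ∀ i, i < r → T i ∈ W) :
    coxeter T r ∈ W :=
  W.list_prod_mem fun x hx => by
    obtain ⟨i, hi, rfl⟩ := List.mem_map.mp hx
    exact h i (List.mem_range.mp hi)

/-- As a braid, the Coxeter element carries one strand across all the others, which moves the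
remaining crossings by one place. -/
lemma coxeter_semiconjBy {q : K} {T : ℕ → E} :
    ∀ {r : ℕ}, IsHecke q T r → ∀ i, i + 1 < r → SemiconjBy (coxeter T r) (T i) (T (i + 1))
  | 0, _, _, hi => by omega
  | 1, _, _, hi => by omega
  | r + 2, hT, i, hi => by
    rw [coxeter_succ]
    by_cases hir : i + 1 < r + 1
    · exact (coxeter_semiconjBy (hT.mono (by omega)) i hir).mul_left
        (hT.comm i (r + 1) (by omega) (by omega)).symm
    obtain rfl : i = r := by omega
    rw [coxeter_succ, mul_assoc]
    refine SemiconjBy.mul_left (y := T (i + 1)) ?_ ?_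
    · have : coxeter T i ∈ Subalgebra.centralizer K {T (i + 1)} :=
        coxeter_mem T i _ fun j hj => by
          rw [Subalgebra.mem_centralizer_iff]
          rintro g rfl
          exact (hT.comm j (i + 1) (by omega) (by omega)).symm.eq
      rw [Subalgebra.mem_centralizer_iff] at this
      exact (this _ rfl).symm
    · have := hT.braid i (by omega)
      rw [SemiconjBy, ← mul_assoc]
      exact this

/-- The shift by one place runs out at the last generator; this is the step that wraps around to the
first one, at the cost of a second power. -/
lemma coxeter_sq_semiconjBy {q : K} {T : ℕ → E} {r : ℕ} (hT : IsHecke q T (r + 1)) :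
    SemiconjBy (coxeter T (r + 1) ^ 2) (T r) (T 0) := by
  set C := coxeter T (r + 1) with hC
  have h0 : C = T 0 * ((List.range r).map fun i => T (i + 1)).prod := by
    rw [hC, coxeter, List.range_succ_eq_map, List.map_cons, List.prod_cons, List.map_map]
    rfl
  have h1 : SemiconjBy C (coxeter T r) ((List.range r).map fun i => T (i + 1)).prod := by
    have : ∀ s ≤ r, SemiconjBy C (coxeter T s) ((List.range s).map fun i => T (i + 1)).prod := by
      intro s
      induction s with
      | zero => intro _; simp [coxeter]
      | succ s ih =>
        intro hs
        rw [coxeter_succ, List.range_succ, List.map_append, List.prod_append]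
        refine (ih (by omega)).mul_right ?_
        simpa using coxeter_semiconjBy hT s (by omega)
    exact this r le_rfl
  rw [SemiconjBy, pow_two]
  calc C * C * T r = T 0 * (((List.range r).map fun i => T (i + 1)).prod * C) * T r := by
        nth_rewrite 1 [h0]; simp only [mul_assoc]
    _ = T 0 * (C * (coxeter T r * T r)) := by rw [← h1.eq]; simp only [mul_assoc]
    _ = T 0 * (C * C) := by rw [← coxeter_succ]

lemma IsHecke.isUnit {q : K} {T : ℕ → E} {r : ℕ} (hT : IsHecke q T r) {i : ℕ} (hi : i < r) :
    IsUnit (T i) := by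
  refine ⟨⟨T i, T i - (q - q⁻¹) • 1, ?_, ?_⟩, rfl⟩ <;>
  simp [mul_sub, sub_mul, hT.quad i hi]

lemma coxeter_isUnit {q : K} {T : ℕ → E} {r : ℕ} (hT : IsHecke q T r) :
    IsUnit (coxeter T r) := by
  have : coxeter T r ∈ IsUnit.submonoid E := by
    refine Submonoid.list_prod_mem _ fun x hx => ?_
    obtain ⟨i, hi, rfl⟩ := List.mem_map.mp hx
    exact hT.isUnit (List.mem_range.mp hi)
  exact this

lemma coxeter_pow_semiconjBy {q : K} {T : ℕ → E} {r : ℕ} (hT : IsHecke q T r) (i l : ℕ)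
    (h : i + l < r) : SemiconjBy (coxeter T r ^ l) (T i) (T (i + l)) := by
  induction l with
  | zero => simp
  | succ l ih =>
    rw [pow_succ']
    exact (coxeter_semiconjBy hT (i + l) (by omega)).mul_left (ih (by omega))

/-- The full twist is central. -/
lemma coxeter_pow_succ_commute {q : K} {T : ℕ → E} {r : ℕ} (hT : IsHecke q T r) (i : ℕ)
    (hi : i < r) : Commute (coxeter T r ^ (r + 1)) (T i) := by
  obtain ⟨r, rfl⟩ : ∃ s, r = s + 1 := ⟨r - 1, by omega⟩
  have h1 := coxeter_pow_semiconjBy hT i (r - i) (by omega)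
  rw [show i + (r - i) = r by omega] at h1
  have h3 := coxeter_pow_semiconjBy hT 0 i (by omega)
  rw [zero_add] at h3
  -- The circuit `T i → T r → T 0 → T i` costs `r - i`, then `2`, then `i` powers, in all one more
  -- than the number `r + 1` of generators.
  have h := (h3.mul_left (coxeter_sq_semiconjBy hT)).mul_left h1
  rwa [← pow_add, ← pow_add, show i + 2 + (r - i) = r + 1 + 1 by omega] at h

/-- A power of the Coxeter element exchanges the first `k` strands with the last `l`. -/
lemma coxeter_pow_semiconjBy' {q : K} {T : ℕ → E} {r : ℕ} (hT : IsHecke q T r) (k l j : ℕ)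
    (hkl : k + l = r + 1) (hj : j + 1 < l) :
    SemiconjBy (coxeter T r ^ l) (T (k + j)) (T j) := by
  -- The power `k` takes `T j` to `T (k + j)`, and the power `k + l` is central; cancelling the
  -- invertible power `k` leaves the claim.
  have h1 := coxeter_pow_semiconjBy hT j k (by omega)
  have h2 := coxeter_pow_succ_commute hT j (by omega)
  rw [← hkl, add_comm k l, pow_add] at h2
  rw [SemiconjBy, ← ((coxeter_isUnit hT).pow k).mul_left_inj, mul_assoc _ (T (k + j)),
    add_comm k j, ← h1.eq, ← mul_assoc, h2.eq, mul_assoc]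

end Hecke

/-! ### Formal consequences of the chain axioms: factorization, commutativity and Newton identities
for iterated traces. -/

section Chain

variable {K : Type*} [Field K] {E : Type*} [Ring E] [Algebra K E]

/-- The formal properties of the operators `T = R̂`, `Φ = F̂`, `Φ' = F̂⁻¹`, the copies `M` of the
quantum matrix, the partial quantum traces `tr` and the subalgebras `triv a` of operators that act
trivially in the factor `a`, on a chain of `N` factors. -/
structure QChain (q : K) (N : ℕ) (T Φ Φ' M : ℕ → E) (tr : ℕ → E →ₗ[K] E)
    (triv : ℕ → Subalgebra K E) : Prop where
  hecke : IsHecke q T (N - 1)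
  mul_inv : ∀ i, i + 1 < N → Φ i * Φ' i = 1
  inv_mul : ∀ i, i + 1 < N → Φ' i * Φ i = 1
  braid : ∀ i, i + 2 < N → Φ i * Φ (i + 1) * Φ i = Φ (i + 1) * Φ i * Φ (i + 1)
  comm : ∀ i j, i + 1 < j → j + 1 < N → Commute (Φ i) (Φ j)
  comm_T : ∀ i j, i + 1 < j → j + 1 < N → Commute (T i) (Φ j)
  comm_T' : ∀ i j, i + 1 < j → j + 1 < N → Commute (Φ i) (T j)
  twist : ∀ i, i + 2 < N → T (i + 1) * Φ i * Φ (i + 1) = Φ i * Φ (i + 1) * T i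
  twist' : ∀ i, i + 2 < N → T i * Φ (i + 1) * Φ i = Φ (i + 1) * Φ i * T (i + 1)
  M_succ : ∀ i, i + 1 < N → M (i + 1) = Φ i * M i * Φ' i
  M_comm_T : ∀ i, 0 < i → i + 1 < N → Commute (M 0) (T i)
  M_comm : ∀ i, 0 < i → i + 1 < N → Commute (M 0) (Φ i)
  M_rel : 1 < N → Commute (T 0) (M 0 * M 1)
  T_triv : ∀ i a, i + 1 < N → a < N → a ≠ i → a ≠ i + 1 → T i ∈ triv a
  Φ_triv : ∀ i a, i + 1 < N → a < N → a ≠ i → a ≠ i + 1 → Φ i ∈ triv a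
  Φ'_triv : ∀ i a, i + 1 < N → a < N → a ≠ i → a ≠ i + 1 → Φ' i ∈ triv a
  M_triv : ∀ a, a < N → a ≠ 0 → M 0 ∈ triv a
  tr_mul_left : ∀ a, a < N → ∀ z ∈ triv a, ∀ x, tr a (z * x) = z * tr a x
  tr_mul_right : ∀ a, a < N → ∀ z ∈ triv a, ∀ x, tr a (x * z) = tr a x * z
  tr_triv : ∀ a, a < N → ∀ x, tr a x ∈ triv a
  tr_triv' : ∀ a b, a < N → b < N → ∀ x ∈ triv b, tr a x ∈ triv b
  tr_conj : ∀ i, i + 1 < N → ∀ y ∈ triv (i + 1), tr (i + 1) (Φ i * y * Φ' i) = tr i y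
  tr_cyc : ∀ i, i + 1 < N → ∀ z, tr i (tr (i + 1) (T i * z)) = tr i (tr (i + 1) (z * T i))

/-- The iterated partial trace over the factors `j, …, j + k - 1`. -/
def multiTr (tr : ℕ → E →ₗ[K] E) (j : ℕ) : ℕ → E →ₗ[K] E
  | 0 => LinearMap.id
  | k + 1 => multiTr tr j k ∘ₗ tr (j + k)

lemma multiTr_succ_apply (tr : ℕ → E →ₗ[K] E) (j k : ℕ) (x : E) :
    multiTr tr j (k + 1) x = multiTr tr j k (tr (j + k) x) := rfl

lemma multiTr_add (tr : ℕ → E →ₗ[K] E) (j k l : ℕ) (x : E) :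
    multiTr tr j (k + l) x = multiTr tr j k (multiTr tr (j + k) l x) := by
  induction l generalizing x with
  | zero => rfl
  | succ l ih => rw [← add_assoc, multiTr_succ_apply, ih, multiTr_succ_apply, add_assoc]

/-- The product `M j * M (j + 1) * ⋯ * M (j + k - 1)`. -/
def prodFrom (M : ℕ → E) (j k : ℕ) : E := ((List.range k).map fun i => M (j + i)).prod

lemma prodFrom_succ (M : ℕ → E) (j k : ℕ) :
    prodFrom M j (k + 1) = prodFrom M j k * M (j + k) := by
  simp [prodFrom, List.range_succ]

lemma prodFrom_zero (M : ℕ → E) (j : ℕ) : prodFrom M j 0 = 1 := rfl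

lemma prodFrom_add (M : ℕ → E) (j k l : ℕ) :
    prodFrom M j (k + l) = prodFrom M j k * prodFrom M (j + k) l := by
  induction l with
  | zero => simp [prodFrom_zero]
  | succ l ih => rw [← add_assoc, prodFrom_succ, ih, prodFrom_succ, mul_assoc, add_assoc]

lemma prodFrom_mem (M : ℕ → E) (j k : ℕ) (W : Subalgebra K E)
    (h : ∀ i, i < k → M (j + i) ∈ W) : prodFrom M j k ∈ W :=
  W.list_prod_mem fun x hx => by
    obtain ⟨i, hi, rfl⟩ := List.mem_map.mp hx
    exact h i (List.mem_range.mp hi)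

lemma prodFrom_semiconjBy {M : ℕ → E} {g : E} (j j' k : ℕ)
    (h : ∀ i, i < k → SemiconjBy g (M (j + i)) (M (j' + i))) :
    SemiconjBy g (prodFrom M j k) (prodFrom M j' k) := by
  induction k with
  | zero => exact SemiconjBy.one_right g
  | succ k ih =>
    rw [prodFrom_succ, prodFrom_succ]
    exact (ih fun i hi => h i (by omega)).mul_right (h k (by omega))

/-- The product `Φ j * ⋯ * Φ (j + k - 1)`. -/
abbrev shiftOp (Φ : ℕ → E) (j k : ℕ) : E := prodFrom Φ j k

/-- The product `Φ' (j + k - 1) * ⋯ * Φ' j`. -/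
def shiftInv (Φ' : ℕ → E) (j : ℕ) : ℕ → E
  | 0 => 1
  | k + 1 => Φ' (j + k) * shiftInv Φ' j k

namespace QChain

variable {q : K} {N : ℕ} {T Φ Φ' M : ℕ → E} {tr : ℕ → E →ₗ[K] E} {triv : ℕ → Subalgebra K E}
variable (h : QChain q N T Φ Φ' M tr triv)
include h

lemma commute_inv {x : E} {i : ℕ} (hi : i + 1 < N) (hx : Commute x (Φ i)) : Commute x (Φ' i) := by
  have h1 := h.mul_inv i hi
  have h2 := h.inv_mul i hi
  calc x * Φ' i = Φ' i * (Φ i * x) * Φ' i := by rw [← mul_assoc, h2, one_mul]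
    _ = Φ' i * x := by rw [← hx.eq, mul_assoc, mul_assoc, h1, mul_one]

lemma M_triv_of_lt : ∀ j a, j < a → a < N → M j ∈ triv a
  | 0, a, hj, ha => h.M_triv a ha (by omega)
  | j + 1, a, hj, ha => by
    rw [h.M_succ j (by omega)]
    exact mul_mem (mul_mem (h.Φ_triv j a (by omega) ha (by omega) (by omega))
      (M_triv_of_lt j a (by omega) ha)) (h.Φ'_triv j a (by omega) ha (by omega) (by omega))

lemma M_commute_of_lt : ∀ j i, j < i → i + 1 < N → Commute (M j) (T i) ∧ Commute (M j) (Φ i)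
  | 0, i, hj, hi => ⟨h.M_comm_T i hj hi, h.M_comm i hj hi⟩
  | j + 1, i, hj, hi => by
    rw [h.M_succ j (by omega)]
    obtain ⟨h1, h2⟩ := M_commute_of_lt j i (by omega) hi
    have h3 := h.comm_T' j i (by omega) hi
    have h4 := h.comm j i (by omega) hi
    exact ⟨(h3.mul_left h1).mul_left (h.commute_inv (by omega) h3.symm).symm,
      (h4.mul_left h2).mul_left (h.commute_inv (by omega) h4.symm).symm⟩

/-- Conjugation by `Φ (i + 1) * Φ i` takes `M i` to `M (i + 2)`. By `twist'` and `braid` it takes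
the index `i + 1` of `T` and `Φ` to `i`, so commutation to the right of a copy becomes commutation
to its left. -/
lemma M_commute_of_gt_aux {x y : E} {i : ℕ} (hi : i + 2 < N)
    (hxy : SemiconjBy (Φ (i + 1) * Φ i) x y) (hx : Commute x (M i)) : Commute y (M (i + 2)) := by
  have h1 := h.mul_inv i (by omega)
  have h2 := h.inv_mul i (by omega)
  have h3 := h.mul_inv (i + 1) (by omega)
  have h4 := h.inv_mul (i + 1) (by omega)
  have hM : M (i + 2) * (Φ (i + 1) * Φ i) = Φ (i + 1) * Φ i * M i := by
    rw [h.M_succ (i + 1) (by omega), h.M_succ i (by omega)]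
    calc _ = Φ (i + 1) * Φ i * M i * (Φ' i * (Φ' (i + 1) * Φ (i + 1)) * Φ i) := by
            simp only [mul_assoc]
      _ = _ := by rw [h4, mul_one, h2, mul_one]
  have hG : Φ (i + 1) * Φ i * (Φ' i * Φ' (i + 1)) = 1 := by
    rw [mul_assoc, ← mul_assoc (Φ i), h1, one_mul, h3]
  have h5 : y * M (i + 2) * (Φ (i + 1) * Φ i) = M (i + 2) * y * (Φ (i + 1) * Φ i) := by
    rw [mul_assoc, hM, ← mul_assoc, ← hxy.eq, mul_assoc, hx.eq, ← mul_assoc, ← hM, mul_assoc,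
      hxy.eq, mul_assoc]
  have h6 := congrArg (· * (Φ' i * Φ' (i + 1))) h5
  rwa [mul_assoc, hG, mul_one, mul_assoc, hG, mul_one] at h6

lemma M_commute_of_gt : ∀ j i, i + 2 ≤ j → j < N → Commute (T i) (M j) ∧ Commute (Φ i) (M j)
  | 0, i, hj, _ => by omega
  | 1, i, hj, _ => by omega
  | j + 2, i, hj, hi => by
    by_cases hij : i = j
    · subst hij
      obtain ⟨h1, h2⟩ := h.M_commute_of_lt i (i + 1) (by omega) (by omega)
      constructor
      · refine h.M_commute_of_gt_aux hi ?_ h1.symm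
        rw [SemiconjBy, ← h.twist' i hi, mul_assoc]
      · refine h.M_commute_of_gt_aux hi ?_ h2.symm
        rw [SemiconjBy, ← h.braid i hi, mul_assoc]
    · obtain ⟨h1, h2⟩ := M_commute_of_gt (j + 1) i (by omega) (by omega)
      rw [h.M_succ (j + 1) (by omega)]
      have h3 := h.comm_T i (j + 1) (by omega) (by omega)
      have h4 := h.comm i (j + 1) (by omega) (by omega)
      exact ⟨(h3.mul_right h1).mul_right (h.commute_inv (by omega) h3),
        (h4.mul_right h2).mul_right (h.commute_inv (by omega) h4)⟩

lemma Φ_semiconjBy (i : ℕ) (hi : i + 1 < N) : SemiconjBy (Φ i) (M i) (M (i + 1)) := by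
  rw [h.M_succ i hi, SemiconjBy, mul_assoc _ (Φ' i), h.inv_mul i hi, mul_one]

/-- Conjugation by `Φ j * Φ (j + 1)` moves `T j`, `M j` and `M (j + 1)` one place to the right, so
the defining relation propagates along the chain. -/
lemma M_rel_of_lt : ∀ j, j + 1 < N → Commute (T j) (M j * M (j + 1))
  | 0, hj => h.M_rel hj
  | j + 1, hj => by
    have ih := M_rel_of_lt j (by omega)
    have s0 : SemiconjBy (Φ j * Φ (j + 1)) (M j) (M (j + 1)) :=
      (h.Φ_semiconjBy j (by omega)).mul_left (h.M_commute_of_lt j (j + 1) (by omega) hj).2.symm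
    have s1 : SemiconjBy (Φ j * Φ (j + 1)) (M (j + 1)) (M (j + 2)) :=
      SemiconjBy.mul_left (h.M_commute_of_gt (j + 2) j (by omega) hj).2
        (h.Φ_semiconjBy (j + 1) hj)
    have s2 : SemiconjBy (Φ j * Φ (j + 1)) (T j) (T (j + 1)) := by
      rw [SemiconjBy, ← h.twist j hj, mul_assoc]
    have h3 := h.mul_inv (j + 1) (by omega)
    have h1 := h.mul_inv j (by omega)
    have hG : Φ j * Φ (j + 1) * (Φ' (j + 1) * Φ' j) = 1 := by
      rw [mul_assoc, ← mul_assoc (Φ (j + 1)), h3, one_mul, h1]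
    have e1 := (s2.mul_right (s0.mul_right s1)).eq
    have e2 := ((s0.mul_right s1).mul_right s2).eq
    rw [ih.eq, e2] at e1
    have h6 := congrArg (· * (Φ' (j + 1) * Φ' j)) e1
    rw [mul_assoc, hG, mul_one, mul_assoc (_ * _) (_ * _), hG, mul_one] at h6
    exact h6.symm

/-- `T i` commutes with the copies before and after positions `i`, `i + 1` one by one, and with the
two at these positions only as a pair. -/
lemma T_commute_prodFrom (j k i : ℕ) (hk : j + k ≤ N) (hij : j ≤ i) (hi : i + 1 < j + k) :
    Commute (T i) (prodFrom M j k) := by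
  obtain ⟨a, rfl⟩ : ∃ a, i = j + a := ⟨i - j, by omega⟩
  obtain ⟨b, rfl⟩ : ∃ b, k = (a + 2) + b := ⟨k - (a + 2), by omega⟩
  rw [prodFrom_add, prodFrom_succ, prodFrom_succ, mul_assoc (prodFrom M j a)]
  refine ((?_ : Commute _ _).mul_right (h.M_rel_of_lt (j + a) (by omega))).mul_right ?_
  · exact prodFrom_semiconjBy j j a fun i hi =>
      (h.M_commute_of_lt (j + i) (j + a) (by omega) (by omega)).1.symm
  · exact prodFrom_semiconjBy _ _ b fun i hi =>
      (h.M_commute_of_gt (j + (a + 2) + i) (j + a) (by omega) (by omega)).1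

lemma multiTr_mul_left (j k : ℕ) (hk : j + k ≤ N) (z : E)
    (hz : ∀ a, j ≤ a → a < j + k → z ∈ triv a) (x : E) :
    multiTr tr j k (z * x) = z * multiTr tr j k x := by
  induction k generalizing x with
  | zero => rfl
  | succ k ih =>
    rw [multiTr_succ_apply, h.tr_mul_left (j + k) (by omega) z (hz _ (by omega) (by omega)),
      ih (by omega) fun a h1 h2 => hz a h1 (by omega), multiTr_succ_apply]

lemma multiTr_mul_right (j k : ℕ) (hk : j + k ≤ N) (z : E)
    (hz : ∀ a, j ≤ a → a < j + k → z ∈ triv a) (x : E) :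
    multiTr tr j k (x * z) = multiTr tr j k x * z := by
  induction k generalizing x with
  | zero => rfl
  | succ k ih =>
    rw [multiTr_succ_apply, h.tr_mul_right (j + k) (by omega) z (hz _ (by omega) (by omega)),
      ih (by omega) fun a h1 h2 => hz a h1 (by omega), multiTr_succ_apply]

lemma multiTr_triv_of_mem (j k a : ℕ) (hk : j + k ≤ N) (ha : a < N) (x : E) (hx : x ∈ triv a) :
    multiTr tr j k x ∈ triv a := by
  induction k generalizing x with
  | zero => exact hx
  | succ k ih => exact ih (by omega) _ (h.tr_triv' _ _ (by omega) ha x hx)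

lemma multiTr_triv (j k a : ℕ) (hk : j + k ≤ N) (hja : j ≤ a) (ha : a < j + k) (x : E) :
    multiTr tr j k x ∈ triv a := by
  induction k generalizing x with
  | zero => omega
  | succ k ih =>
    rw [multiTr_succ_apply]
    by_cases hak : a < j + k
    · exact ih (by omega) hak _
    · obtain rfl : a = j + k := by omega
      exact h.multiTr_triv_of_mem j k _ (by omega) (by omega) _ (h.tr_triv _ (by omega) _)

/-- The traces over factors beyond `i + 1` are taken first and let `T i` through; then the
two-factor cyclicity `tr_cyc` applies. -/
lemma multiTr_cyc_gen (j k i : ℕ) (hk : j + k ≤ N) (hij : j ≤ i) (hi : i + 1 < j + k) (z : E) :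
    multiTr tr j k (T i * z) = multiTr tr j k (z * T i) := by
  induction k generalizing z with
  | zero => omega
  | succ k ih =>
    by_cases hik : i + 1 < j + k
    · have hT := h.T_triv i (j + k) (by omega) (by omega) (by omega) (by omega)
      rw [multiTr_succ_apply, multiTr_succ_apply, h.tr_mul_left _ (by omega) _ hT,
        h.tr_mul_right _ (by omega) _ hT, ih (by omega) hik]
    · obtain ⟨l, rfl⟩ : ∃ l, k = l + 1 := ⟨k - 1, by omega⟩
      obtain rfl : i = j + l := by omega
      have := h.tr_cyc (j + l) (by omega) z
      simp only [multiTr_succ_apply, ← add_assoc, this]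

/-- The elements with respect to which the iterated trace is cyclic. -/
def cyclic (tr : ℕ → E →ₗ[K] E) (j k : ℕ) : Subalgebra K E where
  carrier := {b | ∀ z, multiTr tr j k (b * z) = multiTr tr j k (z * b)}
  mul_mem' {a b} ha hb z := by rw [mul_assoc, ha, mul_assoc, hb, mul_assoc]
  add_mem' {a b} ha hb z := by rw [add_mul, mul_add, map_add, map_add, ha, hb]
  algebraMap_mem' r z := by rw [Algebra.commutes]

/-- Since `cyclic` is a subalgebra, this extends cyclicity to antisymmetrizers and Coxeter elements.
-/
lemma T_mem_cyclic (j k i : ℕ) (hk : j + k ≤ N) (hij : j ≤ i) (hi : i + 1 < j + k) :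
    T i ∈ cyclic tr j k := h.multiTr_cyc_gen j k i hk hij hi

lemma shiftOp_mul_inv (j k : ℕ) (hk : j + k < N) :
    shiftOp Φ j k * shiftInv Φ' j k = 1 := by
  induction k with
  | zero => exact mul_one 1
  | succ k ih =>
    rw [shiftOp, prodFrom_succ, shiftInv, mul_assoc, ← mul_assoc (Φ (j + k)),
      h.mul_inv (j + k) (by omega), one_mul, ih (by omega)]

lemma shiftOp_semiconjBy_M (j k i : ℕ) (hk : j + k < N) (hi : i < k) :
    SemiconjBy (shiftOp Φ j k) (M (j + i)) (M (j + 1 + i)) := by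
  induction k with
  | zero => omega
  | succ k ih =>
    rw [shiftOp, prodFrom_succ]
    by_cases hik : i < k
    · exact (ih (by omega) hik).mul_left
        (h.M_commute_of_lt (j + i) (j + k) (by omega) (by omega)).2.symm
    · obtain rfl : i = k := by omega
      refine SemiconjBy.mul_left ?_ (h.Φ_semiconjBy (j + i) (by omega))
      rw [show j + 1 + i = j + i + 1 by omega]
      have : Commute (M (j + i + 1)) (prodFrom Φ j i) :=
        prodFrom_semiconjBy j j i fun a ha =>
          (h.M_commute_of_gt (j + i + 1) (j + a) (by omega) (by omega)).2.symm
      exact this.symm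

lemma shiftOp_semiconjBy_T (j k i : ℕ) (hk : j + k < N) (hi : i + 1 < k) :
    SemiconjBy (shiftOp Φ j k) (T (j + i)) (T (j + 1 + i)) := by
  induction k with
  | zero => omega
  | succ k ih =>
    rw [shiftOp, prodFrom_succ]
    by_cases hik : i + 1 < k
    · exact (ih (by omega) hik).mul_left (h.comm_T (j + i) (j + k) (by omega) (by omega)).symm
    · obtain rfl : k = i + 1 := by omega
      rw [prodFrom_succ, mul_assoc, show j + 1 + i = j + i + 1 by omega]
      refine SemiconjBy.mul_left (y := T (j + i + 1)) ?_ ?_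
      · have : Commute (T (j + i + 1)) (prodFrom Φ j i) :=
          prodFrom_semiconjBy j j i fun a ha =>
            (h.comm_T' (j + a) (j + i + 1) (by omega) (by omega)).symm
        exact this.symm
      · rw [SemiconjBy, ← add_assoc, ← h.twist (j + i) (by omega), mul_assoc]

/-- Only the last `Φ` of the product touches the last factor. There `tr_conj` replaces the trace by
the one a place to the left, and the shorter product remains. -/
lemma multiTr_shift (j k : ℕ) (hk : j + k < N) (z : E) (hz : z ∈ triv (j + k)) :
    multiTr tr (j + 1) k (shiftOp Φ j k * z * shiftInv Φ' j k) = multiTr tr j k z := by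
  induction k generalizing z with
  | zero => simp [multiTr, shiftInv, shiftOp, prodFrom_zero]
  | succ k ih =>
    have h1 : shiftOp Φ j k ∈ triv (j + k + 1) :=
      prodFrom_mem _ _ _ _ fun i hi => h.Φ_triv _ _ (by omega) (by omega) (by omega) (by omega)
    have h2 : ∀ l ≤ k, shiftInv Φ' j l ∈ triv (j + k + 1) := by
      intro l
      induction l with
      | zero => intro _; exact one_mem _
      | succ l ih =>
        intro hl
        exact mul_mem (h.Φ'_triv _ _ (by omega) (by omega) (by omega) (by omega)) (ih (by omega))
    have e : shiftOp Φ j (k + 1) * z * shiftInv Φ' j (k + 1)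
        = shiftOp Φ j k * (Φ (j + k) * z * Φ' (j + k) * shiftInv Φ' j k) := by
      rw [shiftOp, prodFrom_succ, shiftInv]
      simp only [mul_assoc]
    rw [e, multiTr_succ_apply, show j + 1 + k = j + k + 1 by omega,
      h.tr_mul_left _ (by omega) _ h1, h.tr_mul_right _ (by omega) _ (h2 k le_rfl),
      h.tr_conj (j + k) (by omega) z (by rwa [add_assoc]), ← mul_assoc,
      ih (by omega) _ (h.tr_triv _ (by omega) _), multiTr_succ_apply]

/-- The quantum trace of an antisymmetrized product of copies does not depend on the position. -/
lemma multiTr_antisym_shift (p : K) (j k : ℕ) (hk : j + k ≤ N) :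
    multiTr tr j k (antisym p (fun i => T (j + i)) k * prodFrom M j k)
      = multiTr tr 0 k (antisym p T k * prodFrom M 0 k) := by
  induction j with
  | zero => simp only [zero_add]
  | succ j ih =>
    rw [← ih (by omega)]
    have hs : SemiconjBy (shiftOp Φ j k) (antisym p (fun i => T (j + i)) k * prodFrom M j k)
        (antisym p (fun i => T (j + 1 + i)) k * prodFrom M (j + 1) k) :=
      (antisym_semiconjBy p k fun i hi => h.shiftOp_semiconjBy_T j k i (by omega) hi).mul_right
        (prodFrom_semiconjBy _ _ _ fun i hi => h.shiftOp_semiconjBy_M j k i (by omega) hi)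
    rw [← h.multiTr_shift j k (by omega), hs.eq, mul_assoc,
      h.shiftOp_mul_inv j k (by omega), mul_one]
    exact mul_mem
      (antisym_mem _ _ _ _ fun i hi =>
        h.T_triv _ _ (by omega) (by omega) (by omega) (by omega))
      (prodFrom_mem _ _ _ _ fun i hi => h.M_triv_of_lt _ _ (by omega) (by omega))

/-- Factors below `k` have been traced out and the others were never touched. The result behaves as
a scalar and can leave any further trace. -/
lemma multiTr_antisym_triv (p : K) (k : ℕ) (hk : k ≤ N) (a : ℕ) (ha : a < N) :
    multiTr tr 0 k (antisym p T k * prodFrom M 0 k) ∈ triv a := by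
  by_cases hak : a < k
  · exact h.multiTr_triv 0 k a (by omega) (by omega) (by omega) _
  · refine h.multiTr_triv_of_mem 0 k a (by omega) ha _ (mul_mem ?_ ?_)
    · exact antisym_mem _ _ _ _ fun i hi =>
        h.T_triv _ _ (by omega) (by omega) (by omega) (by omega)
    · exact prodFrom_mem _ _ _ _ fun i hi => h.M_triv_of_lt _ _ (by omega) (by omega)

/-- The last antisymmetrizer commutes with the first `j + m` copies. Tracing its block first yields
the position-independent value of `multiTr_antisym_shift`, which leaves the remaining trace on the
right. -/
lemma multiTr_factor (p : K) (j m l : ℕ) (hN : j + m + l ≤ N) (x : E)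
    (hx : ∀ a, j + m ≤ a → a < j + m + l → x ∈ triv a) :
    multiTr tr j (m + l) (x * antisym p (fun i => T (j + m + i)) l * prodFrom M 0 (j + m + l))
      = multiTr tr j m (x * prodFrom M 0 (j + m))
        * multiTr tr 0 l (antisym p T l * prodFrom M 0 l) := by
  have hc : Commute (prodFrom M 0 (j + m)) (antisym p (fun i => T (j + m + i)) l) :=
    antisym_semiconjBy p l fun i hi => Commute.symm <|
      prodFrom_semiconjBy 0 0 _ fun a ha =>
        (h.M_commute_of_lt (0 + a) (j + m + i) (by omega) (by omega)).1.symm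
  have e : x * antisym p (fun i => T (j + m + i)) l * prodFrom M 0 (j + m + l)
      = (x * prodFrom M 0 (j + m))
        * (antisym p (fun i => T (j + m + i)) l * prodFrom M (j + m) l) := by
    rw [prodFrom_add, zero_add]
    rw [mul_assoc x, ← mul_assoc (antisym _ _ _), ← hc.eq]
    simp only [mul_assoc]
  rw [multiTr_add, e, h.multiTr_mul_left (j + m) l hN, h.multiTr_antisym_shift p _ _ hN,
    h.multiTr_mul_right j m (by omega)]
  · exact fun a _ ha => h.multiTr_antisym_triv p l (by omega) a (by omega)
  · exact fun a h1 h2 => mul_mem (hx a h1 h2)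
      (prodFrom_mem _ _ _ _ fun i hi => h.M_triv_of_lt _ _ (by omega) (by omega))

/-- The parameters `p`, `p'` are independent of `q`: only the Hecke relations of `T` enter, not the
projector property. This treats elementary and complete functions together. -/
theorem multiTr_antisym_commute (p p' : K) (k l : ℕ) (hN : k + l ≤ N) :
    Commute (multiTr tr 0 k (antisym p T k * prodFrom M 0 k))
      (multiTr tr 0 l (antisym p' T l * prodFrom M 0 l)) := by
  rcases Nat.eq_zero_or_pos (k + l) with h0 | h0
  · obtain ⟨rfl, rfl⟩ : k = 0 ∧ l = 0 := by omega
    simp [multiTr, antisym, prodFrom_zero]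
  have f : ∀ (p p' : K) (k l : ℕ), k + l ≤ N →
      multiTr tr 0 (k + l) (antisym p T k * antisym p' (fun i => T (k + i)) l
          * prodFrom M 0 (k + l))
        = multiTr tr 0 k (antisym p T k * prodFrom M 0 k)
          * multiTr tr 0 l (antisym p' T l * prodFrom M 0 l) := by
    intro p p' k l hN
    have := h.multiTr_factor p' 0 k l (by omega) (antisym p T k) fun a h1 h2 =>
      antisym_mem _ _ _ _ fun i hi => h.T_triv _ _ (by omega) (by omega) (by omega) (by omega)
    simpa only [zero_add] using this
  obtain ⟨r, hr⟩ : ∃ r, k + l = r + 1 := ⟨k + l - 1, by omega⟩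
  have hT : IsHecke q T r := h.hecke.mono (by omega)
  set C := coxeter T r ^ l with hC
  obtain ⟨u, hu⟩ : IsUnit C := (coxeter_isUnit hT).pow l
  have hCc : C ∈ cyclic tr 0 (k + l) := pow_mem (coxeter_mem T r _ fun i hi =>
    h.T_mem_cyclic 0 (k + l) i (by omega) (by omega) (by omega)) l
  have hCP : Commute C (prodFrom M 0 (k + l)) := by
    have : coxeter T r ∈ Subalgebra.centralizer K {prodFrom M 0 (k + l)} :=
      coxeter_mem T r _ fun i hi => by
        rw [Subalgebra.mem_centralizer_iff]
        rintro g rfl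
        exact (h.T_commute_prodFrom 0 (k + l) i (by omega) (by omega) (by omega)).symm.eq
    rw [Subalgebra.mem_centralizer_iff] at this
    exact Commute.pow_left (this _ rfl).symm l
  -- The `l`-th power of the Coxeter element moves the first block right by `l` places and wraps the
  -- second round to the start.
  have hs : SemiconjBy C (antisym p T k * antisym p' (fun i => T (k + i)) l)
      (antisym p (fun i => T (l + i)) k * antisym p' T l) := by
    refine (antisym_semiconjBy p k fun i hi => ?_).mul_right
      (antisym_semiconjBy p' l fun i hi => ?_)
    · rw [add_comm l i]
      exact coxeter_pow_semiconjBy hT i l (by omega)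
    · exact coxeter_pow_semiconjBy' hT k l i hr hi
  have hc : Commute (antisym p (fun i => T (l + i)) k) (antisym p' T l) :=
    antisym_semiconjBy p' l fun i hi => Commute.symm <| antisym_semiconjBy p k fun j hj =>
      h.hecke.comm _ _ (by omega) (by omega)
  rw [Commute, SemiconjBy, ← f p p' k l hN, ← f p' p l k (by omega), ← hc.eq, add_comm l k]
  set X := antisym p T k * antisym p' (fun i => T (k + i)) l
  set Y := antisym p (fun i => T (l + i)) k * antisym p' T l
  have hX : X * prodFrom M 0 (k + l) = (↑u⁻¹ * (Y * prodFrom M 0 (k + l))) * C := by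
    have h1 : Y * prodFrom M 0 (k + l) * C = ↑u * (X * prodFrom M 0 (k + l)) := by
      rw [mul_assoc Y, ← hCP.eq, ← mul_assoc Y, ← hs.eq, hu, mul_assoc C]
    rw [mul_assoc (↑u⁻¹ : E), h1, ← mul_assoc, Units.inv_mul, one_mul]
  rw [hX, ← hCc, ← hu, ← mul_assoc, Units.mul_inv, one_mul]

/-- The Cayley–Hamilton–Newton identities for iterated traces. -/
theorem multiTr_newton (hq : Generic q) (p : ℕ) (hN : p + 1 ≤ N) :
    qInt q (p + 1) • multiTr tr 1 p (antisym q T (p + 1) * prodFrom M 0 (p + 1))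
      = ∑ k ∈ Finset.range (p + 1), (-1) ^ (p + 1 - k + 1) *
          (multiTr tr 1 (p - k) (coxeter T (p - k) * prodFrom M 0 (p - k + 1))
            * (q ^ k • multiTr tr 0 k (antisym q T k * prodFrom M 0 k))) := by
  -- Interpolates between `k = 0`, where only the top power of `M` occurs, and `k = p`, where the
  -- Coxeter element is empty and the full antisymmetrizer appears.
  have key : ∀ k ≤ p, qInt q (k + 1) • multiTr tr 1 p (coxeter T (p - k)
        * antisym q (fun i => T (p - k + i)) (k + 1) * prodFrom M 0 (p + 1))
      = ∑ k' ∈ Finset.range (k + 1), (-1) ^ (k - k') *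
          (multiTr tr 1 (p - k') (coxeter T (p - k') * prodFrom M 0 (p - k' + 1))
            * (q ^ k' • multiTr tr 0 k' (antisym q T k' * prodFrom M 0 k'))) := by
    intro k
    induction k with
    | zero =>
      intro _
      simp [antisym, qInt_one hq.sub_inv_ne, multiTr, prodFrom_zero]
    | succ k ih =>
      intro hk
      obtain ⟨m, rfl⟩ : ∃ m, p = m + (k + 1) := ⟨p - (k + 1), by omega⟩
      have ih := ih (by omega)
      rw [show m + (k + 1) - k = m + 1 by omega] at ih
      rw [show m + (k + 1) - (k + 1) = m by omega, Finset.sum_range_succ, Nat.sub_self, pow_zero,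
        one_mul, show m + (k + 1) - (k + 1) = m by omega]
      have hs : ∑ k' ∈ Finset.range (k + 1), (-1) ^ (k + 1 - k') *
          (multiTr tr 1 (m + (k + 1) - k') (coxeter T (m + (k + 1) - k')
            * prodFrom M 0 (m + (k + 1) - k' + 1))
            * (q ^ k' • multiTr tr 0 k' (antisym q T k' * prodFrom M 0 k')))
          = - ∑ k' ∈ Finset.range (k + 1), (-1) ^ (k - k') *
          (multiTr tr 1 (m + (k + 1) - k') (coxeter T (m + (k + 1) - k')
            * prodFrom M 0 (m + (k + 1) - k' + 1))
            * (q ^ k' • multiTr tr 0 k' (antisym q T k' * prodFrom M 0 k'))) := by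
        rw [← Finset.sum_neg_distrib]
        refine Finset.sum_congr rfl fun k' hk' => ?_
        rw [Finset.mem_range] at hk'
        rw [show k + 1 - k' = (k - k') + 1 by omega, pow_succ, mul_neg_one, neg_mul]
      rw [hs, ← ih]
      set B := antisym q (fun i => T (m + 1 + i)) (k + 1) with hB
      set P := prodFrom M 0 (m + (k + 1) + 1) with hP
      -- The left recursion is needed: the generator `T m` that it adds prolongs `coxeter T m` to
      -- `coxeter T (m + 1)`.
      have hrec := antisym_succ_left hq (h.hecke.shift m (show m + (k + 1) ≤ N - 1 by omega))
      have hB' : antisym q (fun i => T (m + (1 + i))) (k + 1) = B := by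
        simp only [hB, add_assoc]
      simp only [add_zero] at hrec
      rw [hB'] at hrec
      have hBB : B * B = B := antisym_mul_self hq
        (h.hecke.shift (m + 1) (show m + 1 + k ≤ N - 1 by omega)) (k + 1) le_rfl
      have hBC : Commute (coxeter T m) B := antisym_semiconjBy q _ fun i hi => by
        have : coxeter T m ∈ Subalgebra.centralizer K {T (m + 1 + i)} :=
          coxeter_mem T m _ fun j hj => by
            rw [Subalgebra.mem_centralizer_iff]
            rintro g rfl
            exact (h.hecke.comm j (m + 1 + i) (by omega) (by omega)).symm.eq
        rw [Subalgebra.mem_centralizer_iff] at this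
        exact (this _ rfl).symm
      have hBP : Commute P B := antisym_semiconjBy q _ fun i hi =>
        (h.T_commute_prodFrom 0 _ (m + 1 + i) (by omega) (by omega) (by omega)).symm
      have hBc : B ∈ cyclic tr 1 (m + (k + 1)) := antisym_mem _ _ _ _ fun i hi =>
        h.T_mem_cyclic _ _ _ (by omega) (by omega) (by omega)
      rw [← map_smul, ← smul_mul_assoc, ← mul_smul_comm, hrec]
      -- The left `B` goes to the front and the right one to the end; by cyclicity they meet, and `B
      -- * B = B`. No generator of `B` touches the untraced factor `0`.
      have e1 : coxeter T m * (B * (q ^ (k + 1) • 1 - qInt q (k + 1) • T m) * B) * P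
          = B * (coxeter T m * (q ^ (k + 1) • 1 - qInt q (k + 1) • T m) * P * B) := by
        rw [mul_assoc _ P B, hBP.eq]
        simp only [← mul_assoc, hBC.eq]
      have e2 : coxeter T m * (q ^ (k + 1) • 1 - qInt q (k + 1) • T m) * P * B * B
          = q ^ (k + 1) • (coxeter T m * B * P)
            - qInt q (k + 1) • (coxeter T (m + 1) * B * P) := by
        rw [mul_assoc _ B B, hBB, mul_assoc _ P B, hBP.eq, coxeter_succ]
        simp only [mul_sub, sub_mul, mul_smul_comm, smul_mul_assoc, mul_one, mul_assoc]
      rw [e1, hBc, e2, map_sub, map_smul, map_smul]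
      have hf := h.multiTr_factor q 1 m (k + 1) (by omega) (coxeter T m) fun a h1 h2 =>
        coxeter_mem T m _ fun i hi => h.T_triv _ _ (by omega) (by omega) (by omega) (by omega)
      rw [show 1 + m + (k + 1) = m + (k + 1) + 1 by omega, add_comm 1 m] at hf
      rw [hf, mul_smul_comm]
      abel
  have := key p le_rfl
  rw [Nat.sub_self] at this
  simp only [zero_add] at this
  rw [show coxeter T 0 = 1 from rfl, one_mul] at this
  rw [this]
  refine Finset.sum_congr rfl fun k hk => ?_
  rw [Finset.mem_range] at hk
  rw [show p + 1 - k + 1 = (p - k) + 2 by omega, pow_add, neg_one_sq, mul_one]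

end QChain

end Chain

/-! ### Partial quantum traces expressed through commuting matrix units. -/

section Units

variable {K : Type*} [Field K] {E : Type*} [Ring E] [Algebra K E] {κ : Type*} {n : ℕ}

/-- Mutually commuting systems of `n × n` matrix units, one for each `a : κ`. -/
structure MatUnits (e : κ → Fin n → Fin n → E) : Prop where
  mul : ∀ a i j k l, e a i j * e a k l = if j = k then e a i l else 0
  sum : ∀ a, ∑ i, e a i i = 1
  comm : ∀ a b, a ≠ b → ∀ i j k l, Commute (e a i j) (e b k l)

/-- The elements that commute with the matrix units at `a`. -/
def trivAt (K : Type*) [Field K] [Algebra K E] (e : κ → Fin n → Fin n → E) (a : κ) :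
    Subalgebra K E :=
  Subalgebra.centralizer K (Set.range fun p : Fin n × Fin n => e a p.1 p.2)

lemma mem_trivAt {e : κ → Fin n → Fin n → E} {a : κ} {z : E} :
    z ∈ trivAt K e a ↔ ∀ i j, Commute (e a i j) z := by
  rw [trivAt, Subalgebra.mem_centralizer_iff]
  constructor
  · intro h i j
    exact h _ ⟨(i, j), rfl⟩
  · rintro h _ ⟨p, rfl⟩
    exact h p.1 p.2

/-- The `(i, j)` coefficient of an element with respect to the matrix units at `a`. -/
def coeffAt (K : Type*) [Field K] [Algebra K E] (e : κ → Fin n → Fin n → E) (a : κ)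
    (i j : Fin n) : E →ₗ[K] E where
  toFun x := ∑ u, e a u i * x * e a j u
  map_add' x y := by simp only [mul_add, add_mul, Finset.sum_add_distrib]
  map_smul' c x := by
    simp only [mul_smul_comm, smul_mul_assoc, Finset.smul_sum, RingHom.id_apply]

lemma coeffAt_apply (e : κ → Fin n → Fin n → E) (a : κ) (i j : Fin n) (x : E) :
    coeffAt K e a i j x = ∑ u, e a u i * x * e a j u := rfl

/-- The partial trace `Tr (D x)` at `a`. -/
def ptr (D : Matrix (Fin n) (Fin n) K) (e : κ → Fin n → Fin n → E) (a : κ) : E →ₗ[K] E :=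
  ∑ s, ∑ t, D s t • coeffAt K e a t s

lemma ptr_apply (D : Matrix (Fin n) (Fin n) K) (e : κ → Fin n → Fin n → E) (a : κ) (x : E) :
    ptr D e a x = ∑ s, ∑ t, D s t • coeffAt K e a t s x := by
  simp [ptr, LinearMap.sum_apply]

/-- The operator `X` in the factors `a`, `b`, expressed by matrix units. -/
def op2 (e : κ → Fin n → Fin n → E) (a b : κ) (X : Mat2 n K) : E :=
  ∑ i, ∑ j, ∑ k, ∑ l, X (i, j) (k, l) • (e a i k * e b j l)

namespace MatUnits

variable {e : κ → Fin n → Fin n → E} (h : MatUnits e)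
include h

lemma e_mem_trivAt {a b : κ} (hab : a ≠ b) (i j : Fin n) : e a i j ∈ trivAt K e b :=
  mem_trivAt.mpr fun k l => h.comm b a hab.symm k l i j

lemma op2_mem_trivAt {a b c : κ} (hac : a ≠ c) (hbc : b ≠ c) (X : Mat2 n K) :
    op2 e a b X ∈ trivAt K e c :=
  sum_mem fun _ _ => sum_mem fun _ _ => sum_mem fun _ _ => sum_mem fun _ _ =>
    Subalgebra.smul_mem _ (mul_mem (h.e_mem_trivAt hac _ _) (h.e_mem_trivAt hbc _ _)) _

omit h in
lemma op2_commute {a b : κ} (X : Mat2 n K) {z : E} (ha : z ∈ trivAt K e a)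
    (hb : z ∈ trivAt K e b) : Commute (op2 e a b X) z := by
  rw [mem_trivAt] at ha hb
  refine Commute.sum_left _ _ _ fun i _ => Commute.sum_left _ _ _ fun j _ =>
    Commute.sum_left _ _ _ fun k _ => Commute.sum_left _ _ _ fun l _ => ?_
  exact ((ha i k).mul_left (hb j l)).smul_left _

omit h in
lemma coeffAt_mul_left {a : κ} {z : E} (hz : z ∈ trivAt K e a) (i j : Fin n) (x : E) :
    coeffAt K e a i j (z * x) = z * coeffAt K e a i j x := by
  rw [mem_trivAt] at hz
  simp only [coeffAt_apply, Finset.mul_sum]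
  refine Finset.sum_congr rfl fun u _ => ?_
  rw [← mul_assoc, (hz u i).eq]
  simp only [mul_assoc]

omit h in
lemma coeffAt_mul_right {a : κ} {z : E} (hz : z ∈ trivAt K e a) (i j : Fin n) (x : E) :
    coeffAt K e a i j (x * z) = coeffAt K e a i j x * z := by
  rw [mem_trivAt] at hz
  simp only [coeffAt_apply, Finset.sum_mul]
  refine Finset.sum_congr rfl fun u _ => ?_
  simp only [mul_assoc, (hz j u).eq]

lemma coeffAt_mem_trivAt_self (a : κ) (i j : Fin n) (x : E) :
    coeffAt K e a i j x ∈ trivAt K e a := by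
  rw [mem_trivAt]
  intro k l
  have h1 : ∀ u, e a k l * (e a u i * x * e a j u)
      = if l = u then e a k i * x * e a j u else 0 := fun u => by
    rw [← mul_assoc, ← mul_assoc, h.mul]
    split_ifs <;> simp
  have h2 : ∀ u, e a u i * x * e a j u * e a k l
      = if u = k then e a u i * x * e a j l else 0 := fun u => by
    rw [mul_assoc, h.mul]
    split_ifs <;> simp
  rw [Commute, SemiconjBy, coeffAt_apply, Finset.mul_sum, Finset.sum_mul]
  simp only [h1, h2, Finset.sum_ite_eq, Finset.sum_ite_eq', Finset.mem_univ, if_true]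

lemma coeffAt_mem_trivAt {a b : κ} (hab : a ≠ b) (i j : Fin n) {x : E} (hx : x ∈ trivAt K e b) :
    coeffAt K e a i j x ∈ trivAt K e b := by
  rw [coeffAt_apply]
  exact sum_mem fun _ _ => mul_mem (mul_mem (h.e_mem_trivAt hab _ _) hx) (h.e_mem_trivAt hab _ _)

lemma sum_e_mul_coeffAt (a : κ) (x : E) : ∑ i, ∑ j, e a i j * coeffAt K e a i j x = x := by
  have h1 : ∀ i j, e a i j * coeffAt K e a i j x = e a i i * x * e a j j := fun i j => by
    rw [coeffAt_apply, Finset.mul_sum, Finset.sum_eq_single j]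
    · rw [← mul_assoc, ← mul_assoc, h.mul, if_pos rfl]
    · intro u _ hu
      rw [← mul_assoc, ← mul_assoc, h.mul, if_neg hu.symm, zero_mul, zero_mul]
    · simp
  simp only [h1, ← Finset.mul_sum, h.sum, mul_one, ← Finset.sum_mul, one_mul]

lemma coeffAt_e (a : κ) (i j k l : Fin n) :
    coeffAt K e a i j (e a k l) = if i = k ∧ l = j then 1 else 0 := by
  rw [coeffAt_apply]
  by_cases h1 : i = k
  · by_cases h2 : l = j
    · simp [h1, h2, h.mul, h.sum]
    · simp [h1, h2, h.mul]
  · simp [h1, h.mul]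

lemma coeffAt_one (a : κ) (i j : Fin n) :
    coeffAt K e a i j (1 : E) = if i = j then 1 else 0 := by
  rw [coeffAt_apply]
  by_cases h1 : i = j <;> simp [h1, h.mul, h.sum]

lemma coeffAt_comm {a b : κ} (hab : a ≠ b) (i j k l : Fin n) (x : E) :
    coeffAt K e a i j (coeffAt K e b k l x) = coeffAt K e b k l (coeffAt K e a i j x) := by
  simp only [coeffAt_apply, Finset.mul_sum, Finset.sum_mul]
  rw [Finset.sum_comm]
  refine Finset.sum_congr rfl fun v _ => Finset.sum_congr rfl fun u _ => ?_
  calc e a u i * (e b v k * x * e b l v) * e a j u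
      = (e a u i * e b v k) * x * (e b l v * e a j u) := by simp only [mul_assoc]
    _ = (e b v k * e a u i) * x * (e a j u * e b l v) := by
        rw [(h.comm a b hab u i v k).eq, (h.comm a b hab j u l v).eq]
    _ = _ := by simp only [mul_assoc]

lemma coeffAt_op2 {a b : κ} (hab : a ≠ b) (i k : Fin n) (X : Mat2 n K) :
    coeffAt K e a i k (op2 e a b X) = ∑ j, ∑ l, X (i, j) (k, l) • e b j l := by
  have h1 : ∀ i' j k' l, coeffAt K e a i k (e a i' k' * e b j l)
      = if i = i' ∧ k' = k then e b j l else 0 := fun i' j k' l => by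
    rw [coeffAt_mul_right (h.e_mem_trivAt hab.symm _ _), h.coeffAt_e]
    split_ifs <;> simp
  simp only [op2, map_sum, map_smul, h1, ite_and, smul_ite, smul_zero]
  rw [Finset.sum_eq_single i]
  · refine Finset.sum_congr rfl fun j _ => ?_
    rw [Finset.sum_eq_single k]
    · simp
    · intro k' _ hk'; simp [hk']
    · simp
  · intro i' _ hi'; simp [hi'.symm]
  · simp

omit h in
lemma ptr_mul_left (D : Matrix (Fin n) (Fin n) K) {a : κ} {z : E} (hz : z ∈ trivAt K e a)
    (x : E) : ptr D e a (z * x) = z * ptr D e a x := by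
  simp only [ptr_apply, coeffAt_mul_left hz, Finset.mul_sum, mul_smul_comm]

omit h in
lemma ptr_mul_right (D : Matrix (Fin n) (Fin n) K) {a : κ} {z : E} (hz : z ∈ trivAt K e a)
    (x : E) : ptr D e a (x * z) = ptr D e a x * z := by
  simp only [ptr_apply, coeffAt_mul_right hz, Finset.sum_mul, smul_mul_assoc]

lemma ptr_mem_trivAt_self (D : Matrix (Fin n) (Fin n) K) (a : κ) (x : E) :
    ptr D e a x ∈ trivAt K e a := by
  rw [ptr_apply]
  exact sum_mem fun _ _ => sum_mem fun _ _ =>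
    Subalgebra.smul_mem _ (h.coeffAt_mem_trivAt_self _ _ _ _) _

lemma ptr_mem_trivAt (D : Matrix (Fin n) (Fin n) K) (a b : κ) {x : E}
    (hx : x ∈ trivAt K e b) : ptr D e a x ∈ trivAt K e b := by
  by_cases hab : a = b
  · subst hab
    exact h.ptr_mem_trivAt_self D a x
  rw [ptr_apply]
  exact sum_mem fun _ _ => sum_mem fun _ _ =>
    Subalgebra.smul_mem _ (h.coeffAt_mem_trivAt hab _ _ hx) _

lemma ptr_e (D : Matrix (Fin n) (Fin n) K) (a : κ) (i j : Fin n) :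
    ptr D e a (e a i j) = D j i • 1 := by
  simp only [ptr_apply, h.coeffAt_e, ite_and, smul_ite, smul_zero]
  rw [Finset.sum_eq_single j]
  · rw [Finset.sum_eq_single i]
    · simp
    · intro t _ ht; simp [ht]
    · simp
  · intro s _ hs; simp [hs.symm]
  · simp

lemma coeffAt_ptr (D : Matrix (Fin n) (Fin n) K) {a b : κ} (hab : a ≠ b) (i j : Fin n) (x : E) :
    coeffAt K e a i j (ptr D e b x) = ptr D e b (coeffAt K e a i j x) := by
  simp only [ptr_apply, map_sum, map_smul, h.coeffAt_comm hab]

/-- If conjugation followed by the partial trace acts on the matrix units at `a` like the trace,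
then so it does on everything that is trivial at `b`. -/
lemma ptr_conj (D : Matrix (Fin n) (Fin n) K) {a b : κ} (hab : a ≠ b) {Y Y' : Mat2 n K}
    (hY : ∀ i j, ptr D e b (op2 e a b Y * e a i j * op2 e a b Y') = D j i • 1) {y : E}
    (hy : y ∈ trivAt K e b) :
    ptr D e b (op2 e a b Y * y * op2 e a b Y') = ptr D e a y := by
  -- The coefficients of `y` at `a` are trivial at both `a` and `b`, so they pass through the
  -- operators and out of the trace.
  conv_lhs => rw [← h.sum_e_mul_coeffAt (K := K) a y]
  have h1 : ∀ i j, op2 e a b Y * (e a i j * coeffAt K e a i j y) * op2 e a b Y'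
      = op2 e a b Y * e a i j * op2 e a b Y' * coeffAt K e a i j y := fun i j => by
    simp only [mul_assoc]
    rw [(op2_commute Y' (h.coeffAt_mem_trivAt_self a i j y) (h.coeffAt_mem_trivAt hab i j hy)).eq]
  simp only [Finset.mul_sum, Finset.sum_mul, map_sum, h1,
    ptr_mul_right D (h.coeffAt_mem_trivAt hab _ _ hy), hY, smul_mul_assoc, one_mul]
  rw [Finset.sum_comm, ptr_apply]

end MatUnits

/-- The entrywise form of the conditions on a skew inverse. -/
structure IsSkewPair (X Ψ : Mat2 n K) (D : Matrix (Fin n) (Fin n) K) : Prop where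
  left : ∀ u v j l, ∑ i, ∑ k, Ψ (u, k) (v, i) * X (i, j) (k, l)
    = if j = v ∧ l = u then 1 else 0
  trace : ∀ u v, D u v = ∑ i, Ψ (u, i) (v, i)
  norm : ∀ i k, ∑ s, ∑ t, D s t * X (i, t) (k, s) = if i = k then 1 else 0

namespace MatUnits

variable {e : κ → Fin n → Fin n → E} (h : MatUnits e) {X Ψ : Mat2 n K}
  {D : Matrix (Fin n) (Fin n) K} (hX : IsSkewPair X Ψ D)
include h hX

lemma ptr_op2 {a b : κ} (hab : a ≠ b) : ptr D e b (op2 e a b X) = 1 := by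
  have h1 : ∀ i j k l, ptr D e b (e a i k * e b j l) = D l j • e a i k := fun i j k l => by
    rw [ptr_mul_left D (h.e_mem_trivAt hab _ _), h.ptr_e, mul_smul_comm, mul_one]
  simp only [op2, map_sum, map_smul, h1, smul_smul]
  rw [← h.sum a]
  refine Finset.sum_congr rfl fun i _ => ?_
  rw [Finset.sum_comm]
  have h2 : ∀ k, ∑ j, ∑ l, (X (i, j) (k, l) * D l j) • e a i k
      = (if i = k then 1 else 0 : K) • e a i k := fun k => by
    rw [← hX.norm i k, Finset.sum_smul, Finset.sum_comm]
    simp only [Finset.sum_smul, mul_comm]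
  simp only [h2, ite_smul, one_smul, zero_smul, Finset.sum_ite_eq, Finset.mem_univ, if_true]

/-- Skew invertibility in usable form: the coefficients of `X` at `a` span the matrix units at `b`,
so identities about arbitrary operators at `b` reduce to identities about `X`. -/
lemma e_eq_sum_coeffAt {a b : κ} (hab : a ≠ b) (v u : Fin n) :
    e b v u = ∑ i, ∑ k, Ψ (u, k) (v, i) • coeffAt K e a i k (op2 e a b X) := by
  simp only [h.coeffAt_op2 hab, Finset.smul_sum, smul_smul]
  have h1 : ∑ i, ∑ k, ∑ j, ∑ l, (Ψ (u, k) (v, i) * X (i, j) (k, l)) • e b j l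
      = ∑ j, ∑ l, (∑ i, ∑ k, Ψ (u, k) (v, i) * X (i, j) (k, l)) • e b j l := by
    simp only [Finset.sum_smul]
    calc _ = ∑ i, ∑ j, ∑ k, ∑ l, (Ψ (u, k) (v, i) * X (i, j) (k, l)) • e b j l :=
          Finset.sum_congr rfl fun i _ => Finset.sum_comm
      _ = ∑ j, ∑ i, ∑ k, ∑ l, (Ψ (u, k) (v, i) * X (i, j) (k, l)) • e b j l := Finset.sum_comm
      _ = ∑ j, ∑ i, ∑ l, ∑ k, (Ψ (u, k) (v, i) * X (i, j) (k, l)) • e b j l :=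
          Finset.sum_congr rfl fun j _ => Finset.sum_congr rfl fun i _ => Finset.sum_comm
      _ = _ := Finset.sum_congr rfl fun j _ => Finset.sum_comm
  rw [h1]
  simp only [hX.left, ite_and, ite_smul, one_smul, zero_smul]
  rw [Finset.sum_eq_single v]
  · simp
  · intro j _ hj; simp [hj]
  · simp

/-- The partial quantum trace is invariant under conjugation by an operator that satisfies the
twist relation with `X`. -/
lemma ptr_conj_e {a b c : κ} (hab : a ≠ b) (hac : a ≠ c) (hbc : b ≠ c) {Y Y' : Mat2 n K}
    (h0 : op2 e a b Y' * op2 e a b Y = 1) (h1 : op2 e b c Y * op2 e b c Y' = 1)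
    (ht : op2 e b c X * op2 e a b Y * op2 e b c Y = op2 e a b Y * op2 e b c Y * op2 e a b X)
    (v u : Fin n) :
    ptr D e c (op2 e b c Y * e b v u * op2 e b c Y') = D u v • 1 := by
  -- On the left the trace over `c` meets only `X`, where it gives `1`; the right is the conjugation
  -- under study.
  have e1 : op2 e a b Y' * op2 e b c X * op2 e a b Y
      = op2 e b c Y * op2 e a b X * op2 e b c Y' := by
    calc _ = op2 e a b Y' * (op2 e b c X * op2 e a b Y * op2 e b c Y) * op2 e b c Y' := by
          simp only [mul_assoc, h1, mul_one]
      _ = op2 e a b Y' * op2 e a b Y * (op2 e b c Y * op2 e a b X * op2 e b c Y') := by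
          rw [ht]; simp only [mul_assoc]
      _ = _ := by rw [h0, one_mul]
  have e2 : ptr D e c (op2 e b c Y * op2 e a b X * op2 e b c Y') = 1 := by
    rw [← e1, mul_assoc, ptr_mul_left D (h.op2_mem_trivAt hac hbc Y'),
      ptr_mul_right D (h.op2_mem_trivAt hac hbc Y), h.ptr_op2 hX hbc, one_mul, h0]
  -- Coefficients at the auxiliary factor `a` are extracted; contraction with `Ψ` then turns them
  -- into matrix units at `b`, and `δ_ik` into `D`.
  have e3 : ∀ i k, ptr D e c (op2 e b c Y * coeffAt K e a i k (op2 e a b X) * op2 e b c Y')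
      = if i = k then 1 else 0 := fun i k => by
    have := congrArg (coeffAt K e a i k) e2
    rwa [h.coeffAt_one, h.coeffAt_ptr D hac,
      coeffAt_mul_right (h.op2_mem_trivAt hab.symm hac.symm _),
      coeffAt_mul_left (h.op2_mem_trivAt hab.symm hac.symm _)] at this
  rw [h.e_eq_sum_coeffAt hX hab v u]
  simp only [Finset.mul_sum, Finset.sum_mul, map_sum, mul_smul_comm, smul_mul_assoc, map_smul, e3,
    smul_ite, smul_zero, Finset.sum_ite_eq, Finset.mem_univ, if_true]
  rw [hX.trace, Finset.sum_smul]

/-- The quantum trace over two factors is cyclic with respect to the inverse of `X`. -/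
lemma ptr_ptr_cyc {a b : κ} (hab : a ≠ b) {X' : Mat2 n K}
    (hc : ∀ y ∈ trivAt K e b, ptr D e b (op2 e a b X * y * op2 e a b X') = ptr D e a y)
    (hc' : ∀ y ∈ trivAt K e b, ptr D e b (op2 e a b X' * y * op2 e a b X) = ptr D e a y)
    (z : E) :
    ptr D e a (ptr D e b (op2 e a b X' * z)) = ptr D e a (ptr D e b (z * op2 e a b X')) := by
  -- For elements of the form `x X y` both sides equal `ptr D e a x * ptr D e a y`, in this order,
  -- by the two conjugation invariances.
  have key : ∀ x ∈ trivAt K e b, ∀ y ∈ trivAt K e b,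
      ptr D e a (ptr D e b (op2 e a b X' * (x * op2 e a b X * y)))
        = ptr D e a (ptr D e b ((x * op2 e a b X * y) * op2 e a b X')) := by
    intro x hx y hy
    rw [← mul_assoc, ← mul_assoc, ptr_mul_right D hy, hc' x hx,
      ptr_mul_left D (h.ptr_mem_trivAt_self D a x), mul_assoc x, mul_assoc x, ptr_mul_left D hx,
      hc y hy, ptr_mul_right D (h.ptr_mem_trivAt_self D a y)]
  -- Every `z` is a combination of such elements: expand it at `b` and write the matrix units there
  -- through `X`.
  have hz : z = ∑ k, ∑ l, ∑ i, ∑ j, ∑ w, Ψ (l, j) (k, i) •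
      (e a w i * op2 e a b X * (e a j w * coeffAt K e b k l z)) := by
    conv_lhs => rw [← h.sum_e_mul_coeffAt (K := K) b z]
    refine Finset.sum_congr rfl fun k _ => Finset.sum_congr rfl fun l _ => ?_
    rw [h.e_eq_sum_coeffAt hX hab k l]
    simp only [coeffAt_apply, Finset.sum_mul, Finset.smul_sum, smul_mul_assoc, mul_assoc]
  rw [hz]
  simp only [Finset.mul_sum, Finset.sum_mul, map_sum, mul_smul_comm, smul_mul_assoc, map_smul]
  refine Finset.sum_congr rfl fun k _ => Finset.sum_congr rfl fun l _ =>
    Finset.sum_congr rfl fun i _ => Finset.sum_congr rfl fun j _ =>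
    Finset.sum_congr rfl fun w _ => ?_
  rw [key _ (h.e_mem_trivAt hab _ _) _
    (mul_mem (h.e_mem_trivAt hab _ _) (h.coeffAt_mem_trivAt_self b k l z))]

end MatUnits

/-! ### Compatibility of partial traces with algebra homomorphisms. -/

section Map

variable {E' : Type*} [Ring E'] [Algebra K E'] {κ' : Type*} {e : κ → Fin n → Fin n → E}
  {e' : κ' → Fin n → Fin n → E'} (φ : E →ₐ[K] E') {g : κ → κ'}
  (hφ : ∀ a i j, φ (e a i j) = e' (g a) i j)
include hφ

lemma map_coeffAt (a : κ) (i j : Fin n) (x : E) :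
    φ (coeffAt K e a i j x) = coeffAt K e' (g a) i j (φ x) := by
  simp only [coeffAt_apply, map_sum, map_mul, hφ]

lemma map_ptr (D : Matrix (Fin n) (Fin n) K) (a : κ) (x : E) :
    φ (ptr D e a x) = ptr D e' (g a) (φ x) := by
  simp only [ptr_apply, map_sum, map_smul, map_coeffAt φ hφ]

lemma map_op2 (a b : κ) (X : Mat2 n K) : φ (op2 e a b X) = op2 e' (g a) (g b) X := by
  simp only [op2, map_sum, map_smul, map_mul, hφ]

lemma map_ptr_conj (D : Matrix (Fin n) (Fin n) K) (a b : κ) (X Y : Mat2 n K) (i j : Fin n) :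
    φ (ptr D e b (op2 e a b X * e a i j * op2 e a b Y))
      = ptr D e' (g b) (op2 e' (g a) (g b) X * e' (g a) i j * op2 e' (g a) (g b) Y) := by
  rw [map_ptr φ hφ, map_mul φ, map_mul φ, map_op2 φ hφ, map_op2 φ hφ, hφ]

end Map

end Units

/-! ### Matrix units and leg operators on tensor powers; from Yang–Baxter to braid relations. -/

section Legs

variable {n m : ℕ}

section General

variable {S : Type*} [Ring S]

lemma leg1_mul_apply (a : Fin m) (Z : Matrix (Fin n) (Fin n) S) (W : MatT m n S)
    (I J : Fin m → Fin n) :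
    (leg1 a Z * W) I J = ∑ s, Z (I a) s * W (Function.update I a s) J := by
  rw [Matrix.mul_apply]
  symm
  refine Fintype.sum_of_injective (fun s => Function.update I a s)
    (Function.update_injective I a) _ _ ?_ ?_
  · intro L hL
    rw [leg1, Matrix.of_apply, if_neg, zero_mul]
    intro hc
    refine hL ⟨L a, ?_⟩
    funext c
    by_cases h : c = a
    · subst h; simp
    · simp [h, hc c h]
  · intro s
    simp only [leg1, Matrix.of_apply, Function.update_self]
    rw [if_pos]
    intro c hc
    simp [hc]

lemma mul_leg1_apply (a : Fin m) (Z : Matrix (Fin n) (Fin n) S) (W : MatT m n S)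
    (I J : Fin m → Fin n) :
    (W * leg1 a Z) I J = ∑ s, W I (Function.update J a s) * Z s (J a) := by
  rw [Matrix.mul_apply]
  symm
  refine Fintype.sum_of_injective (fun s => Function.update J a s)
    (Function.update_injective J a) _ _ ?_ ?_
  · intro L hL
    rw [leg1, Matrix.of_apply, if_neg, mul_zero]
    intro hc
    refine hL ⟨L a, ?_⟩
    funext c
    by_cases h : c = a
    · subst h; simp
    · simp [h, hc c h]
  · intro s
    simp only [leg1, Matrix.of_apply, Function.update_self]
    rw [if_pos]
    intro c hc
    simp [hc]

lemma leg1_mul_leg1_self (a : Fin m) (Z Z' : Matrix (Fin n) (Fin n) S) :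
    leg1 a Z * leg1 a Z' = leg1 a (Z * Z') := by
  ext I J
  rw [leg1_mul_apply]
  simp only [leg1, Matrix.of_apply, Function.update_self, Matrix.mul_apply]
  have : ∀ s, (∀ c, c ≠ a → Function.update I a s c = J c) ↔ (∀ c, c ≠ a → I c = J c) :=
    fun s => forall_congr' fun c => imp_congr_right fun hc => by simp [hc]
  simp only [this]
  split_ifs <;> simp

lemma leg1_mul_leg1_apply {a b : Fin m} (hab : a ≠ b) (Z Z' : Matrix (Fin n) (Fin n) S)
    (I J : Fin m → Fin n) :
    (leg1 a Z * leg1 b Z') I J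
      = if ∀ c, c ≠ a → c ≠ b → I c = J c then Z (I a) (J a) * Z' (I b) (J b) else 0 := by
  rw [leg1_mul_apply, Finset.sum_eq_single (J a)]
  · simp only [leg1, Matrix.of_apply, Function.update_of_ne hab.symm]
    have : (∀ c, c ≠ b → Function.update I a (J a) c = J c)
        ↔ (∀ c, c ≠ a → c ≠ b → I c = J c) := by
      refine forall_congr' fun c => ?_
      by_cases h : c = a
      · subst h; simp
      · simp [h]
    simp only [this]
    split_ifs <;> simp
  · intro s _ hs
    simp only [leg1, Matrix.of_apply]
    rw [if_neg, mul_zero]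
    intro hc
    apply hs
    simpa using hc a hab
  · simp

lemma leg1_one (a : Fin m) : leg1 a (1 : Matrix (Fin n) (Fin n) S) = 1 := by
  ext I J
  simp only [leg1, Matrix.of_apply, Matrix.one_apply]
  by_cases h : I = J
  · simp [h]
  · rw [if_neg h]
    split_ifs with h1 h2
    · exact absurd (funext fun c => if hc : c = a then hc ▸ h2 else h1 c hc) h
    · rfl
    · rfl

lemma leg1_sum {ι : Type*} (s : Finset ι) (a : Fin m) (Z : ι → Matrix (Fin n) (Fin n) S) :
    leg1 a (∑ i ∈ s, Z i) = ∑ i ∈ s, leg1 a (Z i) := by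
  ext I J
  simp only [leg1, Matrix.of_apply, Matrix.sum_apply]
  split_ifs <;> simp

lemma leg1_smul {R : Type*} [SMulZeroClass R S] (a : Fin m) (c : R)
    (Z : Matrix (Fin n) (Fin n) S) : leg1 a (c • Z) = c • leg1 a Z := by
  ext I J
  simp only [leg1, Matrix.of_apply, Matrix.smul_apply]
  split_ifs <;> simp

/-- The matrix units in the tensor factor `a`. -/
def unitAt (m n : ℕ) (S : Type*) [Ring S] (a : Fin m) (i j : Fin n) : MatT m n S :=
  leg1 a (Matrix.single i j 1)

lemma matUnits_unitAt : MatUnits (unitAt m n S) where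
  mul a i j k l := by
    rw [unitAt, unitAt, leg1_mul_leg1_self]
    split_ifs with h
    · subst h
      rw [Matrix.single_mul_single_same, one_mul]
      rfl
    · rw [Matrix.single_mul_single_of_ne _ _ _ _ h]
      ext I J
      simp [leg1]
  sum a := by
    simp only [unitAt]
    rw [← leg1_sum, ← leg1_one a]
    congr 1
    exact Matrix.sum_single_one
  comm a b hab i j k l := by
    ext I J
    rw [unitAt, unitAt, leg1_mul_leg1_apply hab, leg1_mul_leg1_apply hab.symm]
    have : (∀ c, c ≠ b → c ≠ a → I c = J c) ↔ (∀ c, c ≠ a → c ≠ b → I c = J c) :=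
      forall_congr' fun c => Imp.swap
    simp only [this, Matrix.single_apply]
    split_ifs <;> simp

/-- `S` is not commutative, so such a matrix need not be central; it commutes with matrix units
because their entries are `0` and `1`. -/
lemma diagonal_mem_trivAt {K : Type*} [Field K] [Algebra K S] (a : Fin m) (s : S) :
    (diagonal fun _ => s : MatT m n S) ∈ trivAt K (unitAt m n S) a := by
  rw [mem_trivAt]
  intro i j
  ext I J
  rw [Matrix.mul_diagonal, Matrix.diagonal_mul]
  simp only [unitAt, leg1, Matrix.of_apply, Matrix.single_apply]
  split_ifs <;> simp

lemma unitAt_mul_diagonal (a : Fin m) (i j : Fin n) (s : S) :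
    unitAt m n S a i j * (diagonal fun _ => s) = leg1 a (Matrix.single i j s) := by
  ext I J
  rw [Matrix.mul_diagonal]
  simp only [unitAt, leg1, Matrix.of_apply, Matrix.single_apply]
  split_ifs <;> simp

lemma leg1_eq_sum (a : Fin m) (Z : Matrix (Fin n) (Fin n) S) :
    leg1 a Z = ∑ i, ∑ j, unitAt m n S a i j * (diagonal fun _ => Z i j) := by
  simp only [unitAt_mul_diagonal, ← leg1_sum]
  rw [← Matrix.matrix_eq_sum_single Z]

lemma leg1_mem_trivAt {K : Type*} [Field K] [Algebra K S] {a b : Fin m} (hab : a ≠ b)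
    (Z : Matrix (Fin n) (Fin n) S) : leg1 a Z ∈ trivAt K (unitAt m n S) b := by
  rw [leg1_eq_sum]
  exact sum_mem fun _ _ => sum_mem fun _ _ =>
    mul_mem (matUnits_unitAt.e_mem_trivAt hab _ _) (diagonal_mem_trivAt _ _)

end General

section Numeric

variable {K : Type*} [Field K]

lemma num_eq_map (S : Type*) [Ring S] [Algebra K S] {ι : Type*} [Fintype ι] [DecidableEq ι]
    (Z : Matrix ι ι K) : num S Z = (Algebra.ofId K S).mapMatrix Z := rfl

lemma num_leg2 (S : Type*) [Ring S] [Algebra K S] {a b : Fin m} (hab : a ≠ b) (X : Mat2 n K) :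
    num S (leg2 a b X) = op2 (unitAt m n S) a b X := by
  ext I J
  simp only [op2, Matrix.sum_apply, Matrix.smul_apply, unitAt, leg1_mul_leg1_apply hab]
  simp only [num, Matrix.map_apply, leg2, Matrix.of_apply]
  split_ifs with h
  · simp only [Matrix.single_apply]
    rw [Finset.sum_eq_single (I a), Finset.sum_eq_single (I b), Finset.sum_eq_single (J a),
      Finset.sum_eq_single (J b)]
    · simp [Algebra.algebraMap_eq_smul_one]
    · intro x _ hx; simp [hx]
    · simp
    · intro x _ hx; simp [hx]
    · simp
    · intro x _ hx; simp [hx]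
    · simp
    · intro x _ hx; simp [hx]
    · simp
  · simp

lemma num_id {ι : Type*} (Z : Matrix ι ι K) : num K Z = Z := by
  ext i j; rfl

lemma leg2_mul_apply {a b : Fin m} (hab : a ≠ b) (X : Mat2 n K) (W : MatT m n K)
    (I J : Fin m → Fin n) :
    (leg2 a b X * W) I J = ∑ p : Fin n × Fin n, X (I a, I b) p
      * W (Function.update (Function.update I a p.1) b p.2) J := by
  rw [Matrix.mul_apply]
  symm
  refine Fintype.sum_of_injective
    (fun p : Fin n × Fin n => Function.update (Function.update I a p.1) b p.2) ?_ _ _ ?_ ?_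
  · intro p p' hp
    have h1 := congrFun hp a
    have h2 := congrFun hp b
    simp only [Function.update_self, Function.update_of_ne hab] at h1 h2
    exact Prod.ext h1 h2
  · intro L hL
    rw [leg2, Matrix.of_apply, if_neg, zero_mul]
    intro hc
    refine hL ⟨(L a, L b), ?_⟩
    funext c
    by_cases h : c = b
    · subst h; simp
    · by_cases h' : c = a
      · subst h'; simp [h]
      · simp [h, h', hc c h' h]
  · intro p
    simp only [leg2, Matrix.of_apply, Function.update_self, Function.update_of_ne hab]
    rw [if_pos]
    intro c hc hc'
    simp [hc, hc']

lemma leg2_mul {a b : Fin m} (hab : a ≠ b) (X Y : Mat2 n K) :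
    (leg2 a b X * leg2 a b Y : MatT m n K) = leg2 a b (X * Y) := by
  ext I J
  rw [leg2_mul_apply hab]
  simp only [leg2, Matrix.of_apply, Function.update_self, Function.update_of_ne hab,
    Matrix.mul_apply]
  have : ∀ p : Fin n × Fin n,
      (∀ c, c ≠ a → c ≠ b → Function.update (Function.update I a p.1) b p.2 c = J c)
        ↔ (∀ c, c ≠ a → c ≠ b → I c = J c) :=
    fun s => forall_congr' fun c => imp_congr_right fun hc => imp_congr_right fun hc' => by
      simp [hc, hc']
  simp only [this]
  split_ifs <;> simp

lemma leg2_one (a b : Fin m) : (leg2 a b 1 : MatT m n K) = 1 := by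
  ext I J
  simp only [leg2, Matrix.of_apply, Matrix.one_apply, Prod.mk.injEq]
  by_cases h : I = J
  · simp [h]
  · rw [if_neg h]
    split_ifs with h1 h2
    · exact absurd (funext fun c => if hc : c = a then hc ▸ h2.1 else
        if hc' : c = b then hc' ▸ h2.2 else h1 c hc hc') h
    · rfl
    · rfl

lemma leg2_add (a b : Fin m) (X Y : Mat2 n K) :
    (leg2 a b (X + Y) : MatT m n K) = leg2 a b X + leg2 a b Y := by
  ext I J
  simp only [leg2, Matrix.of_apply, Matrix.add_apply]
  split_ifs <;> simp

lemma leg2_smul (a b : Fin m) (c : K) (X : Mat2 n K) :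
    (leg2 a b (c • X) : MatT m n K) = c • leg2 a b X := by
  ext I J
  simp only [leg2, Matrix.of_apply, Matrix.smul_apply]
  split_ifs <;> simp

lemma leg2_perm_apply {a b : Fin m} (hab : a ≠ b) (I J : Fin m → Fin n) :
    (leg2 a b (perm n K) : MatT m n K) I J = if I = J ∘ Equiv.swap a b then 1 else 0 := by
  simp only [leg2, perm, Matrix.of_apply, Prod.swap_prod_mk, Prod.mk.injEq]
  rw [← ite_and]
  congr 1
  rw [eq_iff_iff]
  constructor
  · rintro ⟨h1, h2, h3⟩
    funext c
    by_cases hc : c = a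
    · subst hc; simpa using h2
    · by_cases hc' : c = b
      · subst hc'; simpa using h3
      · simp [Equiv.swap_apply_of_ne_of_ne hc hc', h1 c hc hc']
  · rintro rfl
    refine ⟨fun c hc hc' => ?_, ?_, ?_⟩
    · simp [Equiv.swap_apply_of_ne_of_ne hc hc']
    · simp
    · simp

lemma leg2_perm_mul {a b : Fin m} (hab : a ≠ b) (W : MatT m n K) (I J : Fin m → Fin n) :
    (leg2 a b (perm n K) * W) I J = W (I ∘ Equiv.swap a b) J := by
  rw [Matrix.mul_apply, Finset.sum_eq_single (I ∘ Equiv.swap a b)]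
  · rw [leg2_perm_apply hab, if_pos, one_mul]
    funext c; simp
  · intro L _ hL
    rw [leg2_perm_apply hab, if_neg, zero_mul]
    rintro rfl
    apply hL
    funext c; simp
  · simp

lemma mul_leg2_perm {a b : Fin m} (hab : a ≠ b) (W : MatT m n K) (I J : Fin m → Fin n) :
    (W * leg2 a b (perm n K)) I J = W I (J ∘ Equiv.swap a b) := by
  rw [Matrix.mul_apply, Finset.sum_eq_single (J ∘ Equiv.swap a b)]
  · rw [leg2_perm_apply hab, if_pos rfl, mul_one]
  · intro L _ hL
    rw [leg2_perm_apply hab, if_neg hL, mul_zero]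
  · simp

lemma leg2_perm_mul_leg2 {a b : Fin m} (hab : a ≠ b) (c d : Fin m) (X : Mat2 n K) :
    (leg2 a b (perm n K) * leg2 c d X : MatT m n K)
      = leg2 (Equiv.swap a b c) (Equiv.swap a b d) X * leg2 a b (perm n K) := by
  ext I J
  rw [leg2_perm_mul hab, mul_leg2_perm hab]
  simp only [leg2, Matrix.of_apply, Function.comp_apply, Equiv.swap_apply_self]
  congr 1
  rw [eq_iff_iff]
  constructor
  · intro h x hx hx'
    have := h (Equiv.swap a b x) (fun e => hx (by rw [← e, Equiv.swap_apply_self]))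
      (fun e => hx' (by rw [← e, Equiv.swap_apply_self]))
    rwa [Equiv.swap_apply_self] at this
  · intro h x hx hx'
    have := h (Equiv.swap a b x) (fun e => hx ((Equiv.swap a b).injective e))
      (fun e => hx' ((Equiv.swap a b).injective e))
    rwa [Equiv.swap_apply_self] at this

lemma leg2_perm_mul_self {a b : Fin m} (hab : a ≠ b) :
    (leg2 a b (perm n K) * leg2 a b (perm n K) : MatT m n K) = 1 := by
  ext I J
  rw [leg2_perm_mul hab, leg2_perm_apply hab, Matrix.one_apply]
  congr 1
  rw [eq_iff_iff]
  exact (Equiv.swap a b).surjective.injective_comp_right.eq_iff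

lemma leg2_hat {a b : Fin m} (hab : a ≠ b) (R : Mat2 n K) :
    (leg2 a b (hat R) : MatT m n K) = leg2 a b (perm n K) * leg2 a b R := by
  rw [hat, leg2_mul hab]

/-- Yang–Baxter type relations in braid form. -/
lemma hat_braid {A B C : Mat2 n K}
    (h : (leg2 0 1 A * leg2 0 2 B * leg2 1 2 C : MatT 3 n K)
      = leg2 1 2 C * leg2 0 2 B * leg2 0 1 A) :
    (leg2 1 2 (hat A) * leg2 0 1 (hat B) * leg2 1 2 (hat C) : MatT 3 n K)
      = leg2 0 1 (hat C) * leg2 1 2 (hat B) * leg2 0 1 (hat A) := by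
  have h01 : (0 : Fin 3) ≠ 1 := by decide
  have h12 : (1 : Fin 3) ≠ 2 := by decide
  rw [leg2_hat h12, leg2_hat h01, leg2_hat h12, leg2_hat h01, leg2_hat h12, leg2_hat h01]
  set P : MatT 3 n K := leg2 0 1 (perm n K) with hP
  set Q : MatT 3 n K := leg2 1 2 (perm n K) with hQ
  have s0 : Equiv.swap (0 : Fin 3) 1 0 = 1 := by decide
  have s1 : Equiv.swap (0 : Fin 3) 1 1 = 0 := by decide
  have s2 : Equiv.swap (0 : Fin 3) 1 2 = 2 := by decide
  have t0 : Equiv.swap (1 : Fin 3) 2 0 = 0 := by decide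
  have t1 : Equiv.swap (1 : Fin 3) 2 1 = 2 := by decide
  have t2 : Equiv.swap (1 : Fin 3) 2 2 = 1 := by decide
  have p1 : ∀ X : Mat2 n K, P * leg2 0 2 X = leg2 1 2 X * P := fun X => by
    rw [hP, leg2_perm_mul_leg2 h01, s0, s2]
  have p2 : ∀ X : Mat2 n K, P * leg2 1 2 X = leg2 0 2 X * P := fun X => by
    rw [hP, leg2_perm_mul_leg2 h01, s1, s2]
  have q1 : ∀ X : Mat2 n K, Q * leg2 0 2 X = leg2 0 1 X * Q := fun X => by
    rw [hQ, leg2_perm_mul_leg2 h12, t0, t2]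
  have q2 : ∀ X : Mat2 n K, Q * leg2 0 1 X = leg2 0 2 X * Q := fun X => by
    rw [hQ, leg2_perm_mul_leg2 h12, t0, t1]
  have PP : P * P = 1 := leg2_perm_mul_self h01
  have QQ : Q * Q = 1 := leg2_perm_mul_self h12
  have hPQ : Q * P * Q = P * Q * P := by
    rw [hP, q2, mul_assoc, QQ, mul_one, ← hP, hQ, p2, mul_assoc, PP, mul_one]
  -- All flips are collected on the left, where `Q P Q = P Q P`; the hypothesis is applied to the
  -- rest, and the flips are distributed again.
  calc Q * leg2 1 2 A * (P * leg2 0 1 B) * (Q * leg2 1 2 C)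
      = Q * (leg2 1 2 A * P) * (leg2 0 1 B * Q) * leg2 1 2 C := by simp only [mul_assoc]
    _ = Q * P * (leg2 0 2 A * Q) * leg2 0 2 B * leg2 1 2 C := by
        rw [← p1, ← q1]; simp only [mul_assoc]
    _ = Q * P * Q * (leg2 0 1 A * leg2 0 2 B * leg2 1 2 C) := by
        rw [← q2]; simp only [mul_assoc]
    _ = P * Q * P * (leg2 1 2 C * leg2 0 2 B * leg2 0 1 A) := by rw [h, hPQ]
    _ = P * Q * (leg2 0 2 C * P) * leg2 0 2 B * leg2 0 1 A := by
        rw [← p2]; simp only [mul_assoc]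
    _ = P * (leg2 0 1 C * Q) * (leg2 1 2 B * P) * leg2 0 1 A := by
        rw [← q1 C, ← p1 B]; simp only [mul_assoc]
    _ = _ := by simp only [mul_assoc]

end Numeric

end Legs

/-! ### Embedding operators on few factors into longer tensor powers. -/

section Embedding

variable {K : Type*} [Field K] {n m N : ℕ} {S : Type*} [Ring S] [Algebra K S]

/-- Splitting of a multi-index on `N` factors along an injection of `m` factors. -/
def splitEquiv (n : ℕ) (f : Fin m → Fin N) (hf : Function.Injective f) :
    (Fin N → Fin n) ≃ (Fin m → Fin n) × ({c // c ∉ Set.range f} → Fin n) :=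
  (Equiv.piEquivPiSubtypeProd (· ∈ Set.range f) fun _ => Fin n).trans
    (Equiv.prodCongr ((Equiv.ofInjective f hf).symm.arrowCongr (Equiv.refl _)) (Equiv.refl _))

lemma splitEquiv_fst (f : Fin m → Fin N) (hf : Function.Injective f) (I : Fin N → Fin n) :
    (splitEquiv n f hf I).1 = I ∘ f := rfl

/-- An operator on `m` factors as an operator on the factors `f 0, …, f (m - 1)` out of `N`. -/
def embed (K : Type*) [Field K] (n : ℕ) (S : Type*) [Ring S] [Algebra K S] (f : Fin m → Fin N)
    (hf : Function.Injective f) : MatT m n S →ₐ[K] MatT N n S :=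
  AlgHom.ofLinearMap
    { toFun := fun Z => (blockDiagonal fun _ => Z).submatrix (splitEquiv n f hf) (splitEquiv n f hf)
      map_add' := fun Z W => by
        ext I J
        simp only [Matrix.submatrix_apply, Matrix.add_apply, blockDiagonal_apply]
        split_ifs <;> simp
      map_smul' := fun c Z => by
        ext I J
        simp only [Matrix.submatrix_apply, Matrix.smul_apply, blockDiagonal_apply,
          RingHom.id_apply]
        split_ifs <;> simp }
    (by
      change (blockDiagonal fun _ => (1 : MatT m n S)).submatrix _ _ = 1
      have : (blockDiagonal fun _ => (1 : MatT m n S) :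
          Matrix ((Fin m → Fin n) × ({c // c ∉ Set.range f} → Fin n)) _ S) = 1 :=
        blockDiagonal_one
      rw [this, Matrix.submatrix_one_equiv])
    (fun Z W => by
      change (blockDiagonal fun _ => Z * W).submatrix _ _
        = (blockDiagonal fun _ => Z).submatrix _ _ * (blockDiagonal fun _ => W).submatrix _ _
      rw [Matrix.submatrix_mul_equiv, ← blockDiagonal_mul])

lemma embed_apply (f : Fin m → Fin N) (hf : Function.Injective f) (Z : MatT m n S)
    (I J : Fin N → Fin n) :
    embed K n S f hf Z I J
      = if ∀ c, c ∉ Set.range f → I c = J c then Z (I ∘ f) (J ∘ f) else 0 := by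
  change (blockDiagonal fun _ => Z).submatrix (splitEquiv n f hf) (splitEquiv n f hf) I J = _
  rw [Matrix.submatrix_apply, blockDiagonal_apply, splitEquiv_fst, splitEquiv_fst]
  congr 1
  rw [eq_iff_iff, funext_iff, Subtype.forall]
  rfl

lemma embed_injective (f : Fin m → Fin N) (hf : Function.Injective f) (hm : 0 < m) :
    Function.Injective (embed K n S f hf) := by
  intro Z W h
  ext I J
  -- The remaining factors need some common index value; `0 < m` provides one as an entry of `I`.
  have := congrFun (congrFun h ((splitEquiv n f hf).symm (I, fun _ => I ⟨0, hm⟩)))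
    ((splitEquiv n f hf).symm (J, fun _ => I ⟨0, hm⟩))
  change (blockDiagonal fun _ => Z).submatrix (splitEquiv n f hf) (splitEquiv n f hf) _ _
    = (blockDiagonal fun _ => W).submatrix (splitEquiv n f hf) (splitEquiv n f hf) _ _ at this
  simpa [blockDiagonal_apply] using this

lemma embed_leg1 (f : Fin m → Fin N) (hf : Function.Injective f) (a : Fin m)
    (Z : Matrix (Fin n) (Fin n) S) : embed K n S f hf (leg1 a Z) = leg1 (f a) Z := by
  ext I J
  rw [embed_apply]
  simp only [leg1, Matrix.of_apply, Function.comp_apply]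
  rw [← ite_and]
  congr 1
  rw [eq_iff_iff]
  constructor
  · rintro ⟨h1, h2⟩ c hc
    by_cases h : c ∈ Set.range f
    · obtain ⟨d, rfl⟩ := h
      exact h2 d fun e => hc (by rw [e])
    · exact h1 c h
  · intro h
    exact ⟨fun c hc => h c fun e => hc ⟨a, e.symm⟩, fun c hc => h _ fun e => hc (hf e)⟩

lemma embed_unitAt (f : Fin m → Fin N) (hf : Function.Injective f) (a : Fin m) (i j : Fin n) :
    embed K n S f hf (unitAt m n S a i j) = unitAt N n S (f a) i j := embed_leg1 f hf a _

lemma embed_leg2 (f : Fin m → Fin N) (hf : Function.Injective f) {a b : Fin m} (hab : a ≠ b)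
    (X : Mat2 n K) : embed K n K f hf (leg2 a b X) = leg2 (f a) (f b) X := by
  rw [← num_id (leg2 a b X), num_leg2 K hab, map_op2 _ (embed_unitAt f hf), ← num_leg2, num_id]
  exact fun h => hab (hf h)

lemma embed_num_leg2 (f : Fin m → Fin N) (hf : Function.Injective f) {a b : Fin m} (hab : a ≠ b)
    (X : Mat2 n K) : embed K n S f hf (num S (leg2 a b X)) = num S (leg2 (f a) (f b) X) := by
  rw [num_leg2 S hab, map_op2 _ (embed_unitAt f hf), ← num_leg2]
  exact fun h => hab (hf h)

lemma embed_diagonal (f : Fin m → Fin N) (hf : Function.Injective f) (s : S) :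
    embed K n S f hf (diagonal fun _ => s) = diagonal fun _ => s := by
  ext I J
  rw [embed_apply, Matrix.diagonal_apply, Matrix.diagonal_apply, ← ite_and]
  congr 1
  rw [eq_iff_iff]
  constructor
  · rintro ⟨h1, h2⟩
    funext c
    by_cases h : c ∈ Set.range f
    · obtain ⟨d, rfl⟩ := h
      exact congrFun h2 d
    · exact h1 c h
  · rintro rfl
    exact ⟨fun _ _ => rfl, rfl⟩

lemma num_unitAt (a : Fin m) (i j : Fin n) :
    (Algebra.ofId K S).mapMatrix (unitAt m n K a i j) = unitAt m n S a i j := by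
  ext I J
  simp only [AlgHom.mapMatrix_apply, Matrix.map_apply, unitAt, leg1, Matrix.of_apply,
    Matrix.single_apply]
  split_ifs <;> simp

end Embedding

/-! ### Relations for `R̂`, `F̂` and `Ψ`, and the resulting invariance of the quantum trace. -/

section Relations

variable {K : Type*} [Field K] {n : ℕ}

/-- The properties of `X = R̂`, `Y = F̂` used below. -/
structure BraidData (q : K) (X X' Y Y' Ψ : Mat2 n K) (D : Matrix (Fin n) (Fin n) K) : Prop where
  skew : IsSkewPair X Ψ D
  hecke : X * X = (q - q⁻¹) • X + 1
  X_mul : X * X' = 1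
  X_mul' : X' * X = 1
  Y_mul : Y * Y' = 1
  Y_mul' : Y' * Y = 1
  braidX : (leg2 1 2 X * leg2 0 1 X * leg2 1 2 X : MatT 3 n K)
    = leg2 0 1 X * leg2 1 2 X * leg2 0 1 X
  braidY : (leg2 1 2 Y * leg2 0 1 Y * leg2 1 2 Y : MatT 3 n K)
    = leg2 0 1 Y * leg2 1 2 Y * leg2 0 1 Y
  twist : (leg2 1 2 X * leg2 0 1 Y * leg2 1 2 Y : MatT 3 n K)
    = leg2 0 1 Y * leg2 1 2 Y * leg2 0 1 X
  twist' : (leg2 1 2 Y * leg2 0 1 Y * leg2 1 2 X : MatT 3 n K)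
    = leg2 0 1 X * leg2 1 2 Y * leg2 0 1 Y

lemma leg2_zero_one_entry {a b c : Fin n} {x : Mat2 n K} {J : Fin 3 → Fin n} :
    (leg2 0 1 x : MatT 3 n K) ![a, b, c] J = if c = J 2 then x (a, b) (J 0, J 1) else 0 := by
  simp only [leg2, Matrix.of_apply]
  congr 1
  rw [eq_iff_iff]
  constructor
  · intro h; exact h 2 (by decide) (by decide)
  · intro h i h0 h1
    have : i = 2 := by omega
    subst this
    exact h

lemma leg2_one_two_entry {a b c : Fin n} {x : Mat2 n K} {I : Fin 3 → Fin n} :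
    (leg2 1 2 x : MatT 3 n K) I ![a, b, c] = if I 0 = a then x (I 1, I 2) (b, c) else 0 := by
  simp only [leg2, Matrix.of_apply]
  congr 1
  rw [eq_iff_iff]
  constructor
  · intro h; exact h 0 (by decide) (by decide)
  · intro h i h0 h1
    have : i = 0 := by omega
    subst this
    exact h

lemma traceMid_entry (x y : Mat2 n K) (p r : Fin n × Fin n) :
    traceMid (leg2 0 1 x * leg2 1 2 y) p r
      = ∑ s, ∑ a, x (p.1, s) (r.1, a) * y (a, p.2) (s, r.2) := by
  rw [traceMid, Matrix.of_apply]
  refine Finset.sum_congr rfl fun s _ => ?_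
  rw [Matrix.mul_apply]
  symm
  refine Fintype.sum_of_injective (fun a => ![r.1, a, p.2]) ?_ _ _ ?_ ?_
  · intro a b h
    exact congrFun h 1
  · intro L hL
    rw [leg2_zero_one_entry, leg2_one_two_entry]
    split_ifs with h1 h2
    · exact absurd ⟨L 1, by
        funext c
        fin_cases c
        · exact h2.symm
        · rfl
        · exact h1⟩ hL
    · simp
    · simp
    · simp
  · intro a
    rw [leg2_zero_one_entry, leg2_one_two_entry]
    simp

lemma IsSkewInverse.isSkewPair {X Ψ : Mat2 n K} (h : IsSkewInverse X Ψ) :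
    IsSkewPair X Ψ (traceSnd Ψ) where
  left u v j l := by
    have := congrFun (congrFun h.left (u, j)) (v, l)
    rw [traceMid_entry] at this
    rw [Finset.sum_comm, this, perm, Matrix.of_apply]
    simp only [Prod.swap_prod_mk, Prod.mk.injEq]
    congr 1
    rw [eq_iff_iff]
    exact ⟨fun h => ⟨h.2, h.1.symm⟩, fun h => ⟨h.2.symm, h.1⟩⟩
  trace u v := rfl
  norm i k := by
    have : ∀ c, traceMid (leg2 0 1 X * leg2 1 2 Ψ) (i, c) (k, c)
        = if i = c ∧ c = k then 1 else 0 := fun c => by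
      rw [h.right, perm, Matrix.of_apply]
      simp only [Prod.swap_prod_mk, Prod.mk.injEq]
    -- Tracing the third factor of `Tr₂ (X₁₂ Ψ₂₃) = P₁₃` turns `Ψ` into `D` and the flip into the
    -- identity.
    have h2 : ∑ c, traceMid (leg2 0 1 X * leg2 1 2 Ψ) (i, c) (k, c)
        = if i = k then 1 else 0 := by
      simp only [this, ite_and, Finset.sum_ite_eq, Finset.mem_univ, if_true]
    rw [← h2]
    simp only [traceMid_entry, traceSnd, Matrix.of_apply, Finset.sum_mul]
    calc ∑ s, ∑ t, ∑ c, Ψ (s, c) (t, c) * X (i, t) (k, s)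
        = ∑ t, ∑ s, ∑ c, Ψ (s, c) (t, c) * X (i, t) (k, s) := Finset.sum_comm
      _ = ∑ t, ∑ c, ∑ s, Ψ (s, c) (t, c) * X (i, t) (k, s) :=
          Finset.sum_congr rfl fun t _ => Finset.sum_comm
      _ = ∑ c, ∑ t, ∑ s, Ψ (s, c) (t, c) * X (i, t) (k, s) := Finset.sum_comm
      _ = _ := by simp only [mul_comm]

lemma isUnit_perm : IsUnit (perm n K) := by
  have : perm n K * perm n K = 1 := by
    ext x y
    rw [Matrix.mul_apply, Finset.sum_eq_single y.swap]
    · simp [perm, Matrix.one_apply]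
    · intro z _ hz
      simp [perm, hz]
    · simp
  exact ⟨⟨_, _, this, this⟩, rfl⟩

lemma Compatible.braidData {q : K} {R F Ψ : Mat2 n K} (h : Compatible R F) (hF : IsUnit F)
    (hHecke : hat R * hat R = (q - q⁻¹) • hat R + 1) (hΨ : IsSkewInverse (hat R) Ψ) :
    BraidData q (hat R) (hat R - (q - q⁻¹) • 1) (hat F) (hat F)⁻¹ Ψ (traceSnd Ψ) := by
  have hu : IsUnit (hat F).det := (Matrix.isUnit_iff_isUnit_det _).mp (isUnit_perm.mul hF)
  exact {
    skew := hΨ.isSkewPair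
    hecke := hHecke
    X_mul := by rw [mul_sub, hHecke]; simp
    X_mul' := by rw [sub_mul, hHecke]; simp
    Y_mul := Matrix.mul_nonsing_inv _ hu
    Y_mul' := Matrix.nonsing_inv_mul _ hu
    braidX := hat_braid h.ybR
    braidY := hat_braid h.ybF
    twist := hat_braid h.twist₁
    twist' := hat_braid h.twist₂ }

/-- The partial quantum trace of a conjugated matrix unit, for an operator `Y` that satisfies the
twist relation with `X`. -/
lemma ptr_conj_unitAt {X Ψ Y Y' : Mat2 n K} {D : Matrix (Fin n) (Fin n) K}
    (hX : IsSkewPair X Ψ D) (h1 : Y * Y' = 1) (h2 : Y' * Y = 1)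
    (ht : (leg2 1 2 X * leg2 0 1 Y * leg2 1 2 Y : MatT 3 n K)
      = leg2 0 1 Y * leg2 1 2 Y * leg2 0 1 X)
    {N : ℕ} {S : Type*} [Ring S] [Algebra K S] {a b : Fin N} (hab : a ≠ b) (i j : Fin n) :
    ptr D (unitAt N n S) b (op2 (unitAt N n S) a b Y * unitAt N n S a i j
      * op2 (unitAt N n S) a b Y') = D j i • 1 := by
  have h01 : (0 : Fin 3) ≠ 1 := by decide
  have h02 : (0 : Fin 3) ≠ 2 := by decide
  have h12 : (1 : Fin 3) ≠ 2 := by decide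
  have hop : ∀ {a b : Fin 3} (_ : a ≠ b) (Z : Mat2 n K),
      op2 (unitAt 3 n K) a b Z = leg2 a b Z := fun hab Z => by rw [← num_leg2 K hab, num_id]
  -- The argument needs an auxiliary third factor, which the target may lack. It is run on three
  -- factors over `K`, restricted to two by injectivity of `embed`, and then transported to `S` and
  -- `N` factors.
  have key3 := matUnits_unitAt.ptr_conj_e (e := unitAt 3 n K) hX h01 h02 h12 (Y := Y) (Y' := Y')
    (by rw [hop h01, hop h01, leg2_mul h01, h2, leg2_one])
    (by rw [hop h12, hop h12, leg2_mul h12, h1, leg2_one])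
    (by simpa only [hop h01, hop h12] using ht) i j
  let f : Fin 2 → Fin 3 := ![1, 2]
  have hf : Function.Injective f := by decide
  have key2 : ptr D (unitAt 2 n K) 1 (op2 (unitAt 2 n K) 0 1 Y * unitAt 2 n K 0 i j
      * op2 (unitAt 2 n K) 0 1 Y') = D j i • 1 := by
    refine embed_injective (K := K) f hf two_pos ((map_ptr_conj (embed K n K f hf)
      (embed_unitAt f hf) D 0 1 Y Y' i j).trans (key3.trans ?_))
    rw [map_smul, map_one (embed K n K f hf)]
  let g : Fin 2 → Fin N := ![a, b]
  have hg : Function.Injective g := by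
    intro x y hxy
    match x, y with
    | 0, 0 => rfl
    | 1, 1 => rfl
    | 0, 1 => exact absurd hxy hab
    | 1, 0 => exact absurd hxy.symm hab
  have e1 := congrArg (Algebra.ofId K S).mapMatrix key2
  rw [map_ptr_conj _ (g := id) num_unitAt, map_smul, map_one] at e1
  have e2 := congrArg (embed K n S g hg) e1
  rw [map_ptr_conj _ (embed_unitAt g hg), map_smul, map_one] at e2
  exact e2

end Relations

/-! ### The operators on `V ^ ⊗ (p + 1)` satisfy the chain axioms. -/

section Instance

variable {K : Type*} [Field K] {n : ℕ} {S : Type*} [Ring S] [Algebra K S]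

/-- The partial quantum trace over the factor `a` of `V ^ ⊗ N`. -/
def chainTr (D : Matrix (Fin n) (Fin n) K) (N : ℕ) (S : Type*) [Ring S] [Algebra K S] (a : ℕ) :
    MatT N n S →ₗ[K] MatT N n S :=
  if h : a < N then ptr D (unitAt N n S) ⟨a, h⟩ else 0

/-- The operators on `V ^ ⊗ N` that are trivial in the factor `a`. -/
def chainTriv (K : Type*) [Field K] (n N : ℕ) (S : Type*) [Ring S] [Algebra K S] (a : ℕ) :
    Subalgebra K (MatT N n S) :=
  if h : a < N then trivAt K (unitAt N n S) ⟨a, h⟩ else ⊤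

lemma chainTr_of_lt (D : Matrix (Fin n) (Fin n) K) {N a : ℕ} (h : a < N) :
    chainTr D N S a = ptr D (unitAt N n S) ⟨a, h⟩ := dif_pos h

lemma chainTriv_of_lt {N a : ℕ} (h : a < N) :
    chainTriv K n N S a = trivAt K (unitAt N n S) ⟨a, h⟩ := dif_pos h

lemma adj_of_lt (X : Mat2 n K) {N i : ℕ} (h : i + 1 < N) :
    adj N X i = leg2 ⟨i, Nat.lt_of_succ_lt h⟩ ⟨i + 1, h⟩ X := dif_pos h

lemma num_adj (X : Mat2 n K) {N i : ℕ} (h : i + 1 < N) :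
    num S (adj N X i) = op2 (unitAt N n S) ⟨i, Nat.lt_of_succ_lt h⟩ ⟨i + 1, h⟩ X := by
  rw [adj_of_lt X h, num_leg2]
  simp

/-- Operators on three factors acting in the factors `i`, `i + 1`, `i + 2`. -/
lemma exists_hom_three {N i : ℕ} (h : i + 2 < N) :
    ∃ φ : MatT 3 n K →ₐ[K] MatT N n S, ∀ X : Mat2 n K,
      φ (leg2 0 1 X) = num S (adj N X i) ∧ φ (leg2 1 2 X) = num S (adj N X (i + 1)) := by
  let f : Fin 3 → Fin N := fun c => ⟨i + c, by omega⟩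
  have hf : Function.Injective f := by
    intro a b hab
    have := congrArg Fin.val hab
    simp only [f] at this
    omega
  refine ⟨((Algebra.ofId K S).mapMatrix).comp (embed K n K f hf), fun X => ⟨?_, ?_⟩⟩
  · rw [AlgHom.comp_apply, embed_leg2 f hf (by decide), adj_of_lt X (by omega)]
    rfl
  · rw [AlgHom.comp_apply, embed_leg2 f hf (by decide), adj_of_lt X h]
    rfl

lemma num_adj_mul (X Y : Mat2 n K) {N i : ℕ} (h : i + 1 < N) :
    num S (adj N X i) * num S (adj N Y i) = num S (adj N (X * Y) i) := by
  rw [adj_of_lt _ h, adj_of_lt _ h, adj_of_lt _ h, num_eq_map, num_eq_map, ← map_mul, leg2_mul,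
    num_eq_map]
  simp

lemma num_adj_one {N i : ℕ} (h : i + 1 < N) : num S (adj N (1 : Mat2 n K) i) = 1 := by
  rw [adj_of_lt _ h, leg2_one, num_eq_map, map_one]

lemma num_adj_add (X Y : Mat2 n K) {N i : ℕ} (h : i + 1 < N) :
    num S (adj N (X + Y) i) = num S (adj N X i) + num S (adj N Y i) := by
  rw [adj_of_lt _ h, adj_of_lt _ h, adj_of_lt _ h, leg2_add, num_eq_map, map_add]
  rfl

lemma num_adj_smul (c : K) (X : Mat2 n K) {N i : ℕ} (h : i + 1 < N) :
    num S (adj N (c • X) i) = c • num S (adj N X i) := by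
  rw [adj_of_lt _ h, adj_of_lt _ h, leg2_smul, num_eq_map, map_smul]
  rfl

lemma num_adj_mem_chainTriv (X : Mat2 n K) {N i a : ℕ} (h : i + 1 < N) (ha : a < N) (h1 : a ≠ i)
    (h2 : a ≠ i + 1) : num S (adj N X i) ∈ chainTriv K n N S a := by
  rw [num_adj X h, chainTriv_of_lt ha]
  exact matUnits_unitAt.op2_mem_trivAt (by simpa using h1.symm) (by simpa using h2.symm) X

lemma commute_num_adj (X : Mat2 n K) {N i : ℕ} (h : i + 1 < N) {z : MatT N n S}
    (h1 : z ∈ chainTriv K n N S i) (h2 : z ∈ chainTriv K n N S (i + 1)) :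
    Commute (num S (adj N X i)) z := by
  rw [chainTriv_of_lt (by omega)] at h1 h2
  rw [num_adj X h]
  exact MatUnits.op2_commute X h1 h2

lemma num_adj_commute (X Y : Mat2 n K) {N i j : ℕ} (hij : i + 1 < j) (hj : j + 1 < N) :
    Commute (num S (adj N X i)) (num S (adj N Y j)) :=
  commute_num_adj X (by omega)
    (num_adj_mem_chainTriv Y hj (by omega) (by omega) (by omega))
    (num_adj_mem_chainTriv Y hj (by omega) (by omega) (by omega))

lemma leg1_mem_chainTriv (p : ℕ) (M : Matrix (Fin n) (Fin n) S) {a : ℕ} (ha : a < p + 1)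
    (h0 : a ≠ 0) : (leg1 0 M : MatT (p + 1) n S) ∈ chainTriv K n (p + 1) S a := by
  rw [chainTriv_of_lt ha]
  refine leg1_mem_trivAt (fun h => h0 ?_) M
  have := congrArg Fin.val h
  simpa using this.symm

/-- This is the twist relation between `X` and its inverse; it makes the quantum trace invariant
under conjugation by `X'` as well. -/
lemma BraidData.braid_inv {q : K} {X X' Y Y' Ψ : Mat2 n K} {D : Matrix (Fin n) (Fin n) K}
    (h : BraidData q X X' Y Y' Ψ D) :
    (leg2 1 2 X * leg2 0 1 X' * leg2 1 2 X' : MatT 3 n K)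
      = leg2 0 1 X' * leg2 1 2 X' * leg2 0 1 X := by
  have h01 : (0 : Fin 3) ≠ 1 := by decide
  have h12 : (1 : Fin 3) ≠ 2 := by decide
  have i0 : (leg2 0 1 X * leg2 0 1 X' : MatT 3 n K) = 1 := by
    rw [leg2_mul h01, h.X_mul, leg2_one]
  have i0' : (leg2 0 1 X' * leg2 0 1 X : MatT 3 n K) = 1 := by
    rw [leg2_mul h01, h.X_mul', leg2_one]
  have i1 : (leg2 1 2 X * leg2 1 2 X' : MatT 3 n K) = 1 := by
    rw [leg2_mul h12, h.X_mul, leg2_one]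
  have i1' : (leg2 1 2 X' * leg2 1 2 X : MatT 3 n K) = 1 := by
    rw [leg2_mul h12, h.X_mul', leg2_one]
  have hb := h.braidX
  generalize (leg2 0 1 X : MatT 3 n K) = a at *
  generalize (leg2 0 1 X' : MatT 3 n K) = a' at *
  generalize (leg2 1 2 X : MatT 3 n K) = b at *
  generalize (leg2 1 2 X' : MatT 3 n K) = b' at *
  calc b * a' * b' = a' * ((b' * b) * a) * (b * a' * b') := by rw [i1', one_mul, i0', one_mul]
    _ = a' * b' * (b * a * b) * a' * b' := by simp only [mul_assoc]
    _ = a' * b' * a * (b * (a * a')) * b' := by rw [hb]; simp only [mul_assoc]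
    _ = a' * b' * a := by rw [i0, mul_one, mul_assoc _ b b', i1, mul_one]

lemma BraidData.inv_eq {q : K} {X X' Y Y' Ψ : Mat2 n K} {D : Matrix (Fin n) (Fin n) K}
    (h : BraidData q X X' Y Y' Ψ D) : X = X' + (q - q⁻¹) • 1 := by
  have := congrArg (X' * ·) h.hecke
  simp only [← mul_assoc, mul_add, mul_smul_comm, h.X_mul', one_mul, mul_one] at this
  rw [this, add_comm]

/-- The operators on `V ^ ⊗ (p + 1)` form a chain in the sense of `QChain`. -/
theorem qChain {q : K} {X X' Y Ψ : Mat2 n K} {D : Matrix (Fin n) (Fin n) K}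
    (h : BraidData q X X' Y Y⁻¹ Ψ D) {M : Matrix (Fin n) (Fin n) S}
    (hM : (num S (leg2 0 1 X) * quad Y M : MatT 2 n S) = quad Y M * num S (leg2 0 1 X)) (p : ℕ) :
    QChain q (p + 1) (fun i => num S (adj (p + 1) X i)) (fun i => num S (adj (p + 1) Y i))
      (fun i => num S (adj (p + 1) Y⁻¹ i)) (copy Y M p) (chainTr D (p + 1) S)
      (chainTriv K n (p + 1) S) where
  hecke :=
    { quad := fun i hi => by
        have hi : i + 1 < p + 1 := by omega
        rw [num_adj_mul X X hi, h.hecke, num_adj_add _ _ hi, num_adj_smul _ _ hi, num_adj_one hi]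
      braid := fun i hi => by
        obtain ⟨φ, hφ⟩ := exists_hom_three (K := K) (n := n) (S := S)
          (show i + 2 < p + 1 by omega)
        have := congrArg φ h.braidX
        simp only [map_mul, (hφ _).1, (hφ _).2] at this
        exact this.symm
      comm := fun i j hij hj => num_adj_commute X X hij (by omega) }
  mul_inv i hi := by rw [num_adj_mul _ _ hi, h.Y_mul, num_adj_one hi]
  inv_mul i hi := by rw [num_adj_mul _ _ hi, h.Y_mul', num_adj_one hi]
  braid i hi := by
    obtain ⟨φ, hφ⟩ := exists_hom_three (K := K) (n := n) (S := S) hi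
    have := congrArg φ h.braidY
    simp only [map_mul, (hφ _).1, (hφ _).2] at this
    exact this.symm
  comm i j hij hj := num_adj_commute Y Y hij hj
  comm_T i j hij hj := num_adj_commute X Y hij hj
  comm_T' i j hij hj := num_adj_commute Y X hij hj
  twist i hi := by
    obtain ⟨φ, hφ⟩ := exists_hom_three (K := K) (n := n) (S := S) hi
    have := congrArg φ h.twist
    simpa only [map_mul, (hφ _).1, (hφ _).2] using this
  twist' i hi := by
    obtain ⟨φ, hφ⟩ := exists_hom_three (K := K) (n := n) (S := S) hi
    have := congrArg φ h.twist'
    simp only [map_mul, (hφ _).1, (hφ _).2] at this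
    exact this.symm
  M_succ i hi := rfl
  M_comm_T i h0 hi := (commute_num_adj X hi (leg1_mem_chainTriv p M (by omega) (by omega))
    (leg1_mem_chainTriv p M (by omega) (by omega))).symm
  M_comm i h0 hi := (commute_num_adj Y hi (leg1_mem_chainTriv p M (by omega) (by omega))
    (leg1_mem_chainTriv p M (by omega) (by omega))).symm
  M_rel h1 := by
    let f : Fin 2 → Fin (p + 1) := fun c => ⟨c, by omega⟩
    have hf : Function.Injective f := by
      intro a b hab
      have := congrArg Fin.val hab
      simp only [f] at this
      omega
    have h01 : (0 : Fin 2) ≠ 1 := by decide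
    have := congrArg (embed K n S f hf) hM
    simp only [quad, map_mul, embed_leg1, embed_num_leg2 f hf h01] at this
    simp only [copy, adj_of_lt _ h1, Commute, SemiconjBy]
    simp only [mul_assoc] at this ⊢
    exact this
  T_triv i a hi ha h1 h2 := num_adj_mem_chainTriv X hi ha h1 h2
  Φ_triv i a hi ha h1 h2 := num_adj_mem_chainTriv Y hi ha h1 h2
  Φ'_triv i a hi ha h1 h2 := num_adj_mem_chainTriv Y⁻¹ hi ha h1 h2
  M_triv a ha h0 := leg1_mem_chainTriv p M ha h0
  tr_mul_left a ha z hz x := by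
    rw [chainTriv_of_lt ha] at hz
    rw [chainTr_of_lt D ha, MatUnits.ptr_mul_left D hz]
  tr_mul_right a ha z hz x := by
    rw [chainTriv_of_lt ha] at hz
    rw [chainTr_of_lt D ha, MatUnits.ptr_mul_right D hz]
  tr_triv a ha x := by
    rw [chainTriv_of_lt ha, chainTr_of_lt D ha]
    exact matUnits_unitAt.ptr_mem_trivAt_self D _ x
  tr_triv' a b ha hb x hx := by
    rw [chainTriv_of_lt hb] at hx ⊢
    rw [chainTr_of_lt D ha]
    exact matUnits_unitAt.ptr_mem_trivAt D _ _ hx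
  tr_conj i hi y hy := by
    rw [chainTriv_of_lt hi] at hy
    rw [chainTr_of_lt D hi, chainTr_of_lt D (by omega), num_adj _ hi, num_adj _ hi]
    have hab : (⟨i, Nat.lt_of_succ_lt hi⟩ : Fin (p + 1)) ≠ ⟨i + 1, hi⟩ := by simp
    exact matUnits_unitAt.ptr_conj D hab
      (ptr_conj_unitAt h.skew h.Y_mul h.Y_mul' h.twist hab) hy
  tr_cyc i hi z := by
    have hab : (⟨i, Nat.lt_of_succ_lt hi⟩ : Fin (p + 1)) ≠ ⟨i + 1, hi⟩ := by simp
    have hc := matUnits_unitAt.ptr_ptr_cyc (e := unitAt (p + 1) n S) h.skew hab (X' := X')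
      (fun y hy => matUnits_unitAt.ptr_conj D hab
        (ptr_conj_unitAt h.skew h.X_mul h.X_mul' h.braidX hab) hy)
      (fun y hy => matUnits_unitAt.ptr_conj D hab
        (ptr_conj_unitAt h.skew h.X_mul' h.X_mul h.braid_inv hab) hy) z
    -- By the Hecke relation `X` and its inverse differ by a scalar, so cyclicity for one gives it
    -- for the other.
    have hT : num S (adj (p + 1) X i) = num S (adj (p + 1) X' i) + (q - q⁻¹) • 1 := by
      conv_lhs => rw [h.inv_eq]
      rw [num_adj_add _ _ hi, num_adj_smul _ _ hi, num_adj_one hi]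
    rw [← num_adj X' hi] at hc
    rw [chainTr_of_lt D hi, chainTr_of_lt D (by omega), hT, add_mul, mul_add, map_add, map_add,
      map_add, map_add, hc, smul_mul_assoc, mul_smul_comm, one_mul, mul_one]

end Instance

/-! ### Iterated partial traces agree with the entrywise quantum traces. -/

section Traces

variable {K : Type*} [Field K] {n : ℕ} {S : Type*} [Ring S] [Algebra K S]

/-- The matrix unit with row `A a` and column `B a` in the factor `a`. -/
def unitSeq {m : ℕ} (S : Type*) [Ring S] (A B : Fin m → Fin n) (a : ℕ) : MatT m n S :=
  if h : a < m then unitAt m n S ⟨a, h⟩ (A ⟨a, h⟩) (B ⟨a, h⟩) else 1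

lemma prodFrom_unitSeq_apply {m : ℕ} (A B : Fin m → Fin n) (k : ℕ) (hk : k ≤ m)
    (I J : Fin m → Fin n) :
    prodFrom (unitSeq S A B) 0 k I J
      = if ∀ c : Fin m, if c.val < k then I c = A c ∧ J c = B c else I c = J c
        then 1 else 0 := by
  induction k generalizing J with
  | zero => simp [prodFrom_zero, Matrix.one_apply, funext_iff]
  | succ k ih =>
    rw [prodFrom_succ, zero_add, unitSeq, dif_pos (by omega : k < m), unitAt, mul_leg1_apply,
      Finset.sum_eq_single (A ⟨k, by omega⟩)]
    · rw [ih (by omega), Matrix.single_apply]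
      simp only [true_and, mul_ite, mul_one, mul_zero, ← ite_and]
      congr 1
      rw [eq_iff_iff]
      constructor
      · rintro ⟨h1, h2⟩ c
        have h3 := h2 c
        by_cases hc : c = ⟨k, by omega⟩
        · subst hc
          simp only [lt_irrefl, if_false, Function.update_self] at h3
          simp [h3, h1]
        · have hc' : c.val ≠ k := fun e => hc (Fin.ext e)
          rw [Function.update_of_ne hc] at h3
          by_cases hck : c.val < k
          · rw [if_pos hck] at h3
            rwa [if_pos (by omega)]
          · rw [if_neg hck] at h3
            rwa [if_neg (by omega)]
      · intro h
        refine ⟨?_, fun c => ?_⟩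
        · have := h ⟨k, by omega⟩
          simp only [Nat.lt_succ_self, if_true] at this
          exact this.2.symm
        · have h3 := h c
          by_cases hc : c = ⟨k, by omega⟩
          · subst hc
            simp only [Nat.lt_succ_self, if_true] at h3
            simp [h3.1]
          · have hc' : c.val ≠ k := fun e => hc (Fin.ext e)
            rw [Function.update_of_ne hc]
            by_cases hck : c.val < k
            · rw [if_pos (by omega)] at h3
              rwa [if_pos hck]
            · rw [if_neg (by omega)] at h3
              rwa [if_neg hck]
    · intro s _ hs
      rw [Matrix.single_apply, if_neg (fun h => hs h.1.symm), mul_zero]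
    · simp

lemma prodFrom_unitSeq {m : ℕ} (A B : Fin m → Fin n) :
    prodFrom (unitSeq S A B) 0 m = Matrix.single A B 1 := by
  ext I J
  rw [prodFrom_unitSeq_apply A B m le_rfl, Matrix.single_apply]
  congr 1
  rw [eq_iff_iff]
  constructor
  · intro h
    refine ⟨funext fun c => ?_, funext fun c => ?_⟩
    · exact ((if_pos c.2).mp (h c)).1.symm
    · exact ((if_pos c.2).mp (h c)).2.symm
  · rintro ⟨rfl, rfl⟩ c
    simp

/-- Reduces the comparison of traces to products of one matrix unit per factor. The coefficients are
trivial in every factor, so they leave all partial traces. -/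
lemma eq_sum_unitSeq {m : ℕ} (Z : MatT m n S) :
    Z = ∑ A, ∑ B, prodFrom (unitSeq S A B) 0 m * diagonal fun _ => Z A B := by
  conv_lhs => rw [Matrix.matrix_eq_sum_single Z]
  refine Finset.sum_congr rfl fun A _ => Finset.sum_congr rfl fun B _ => ?_
  rw [prodFrom_unitSeq]
  ext I J
  rw [Matrix.mul_diagonal, Matrix.single_apply, Matrix.single_apply]
  split_ifs <;> simp

lemma multiTr_unitSeq (D : Matrix (Fin n) (Fin n) K) {m : ℕ} (A B : Fin m → Fin n) (s : S)
    (j k : ℕ) (hk : j + k ≤ m) :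
    multiTr (chainTr D m S) j k (prodFrom (unitSeq S A B) j k * diagonal fun _ => s)
      = (∏ c : Fin k, D (B ⟨j + c, by omega⟩) (A ⟨j + c, by omega⟩))
        • (diagonal fun _ => s : MatT m n S) := by
  induction k with
  | zero => simp [multiTr, prodFrom_zero]
  | succ k ih =>
    have hjk : j + k < m := by omega
    have hmem : prodFrom (unitSeq S A B) j k ∈ trivAt K (unitAt m n S) ⟨j + k, hjk⟩ := by
      refine prodFrom_mem _ _ _ _ fun i hi => ?_
      rw [unitSeq, dif_pos (by omega)]
      exact matUnits_unitAt.e_mem_trivAt (fun e => by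
        have := congrArg Fin.val e
        simp only at this
        omega) _ _
    rw [multiTr_succ_apply, prodFrom_succ, mul_assoc, chainTr_of_lt D hjk,
      MatUnits.ptr_mul_left D hmem, MatUnits.ptr_mul_right D (diagonal_mem_trivAt _ _),
      unitSeq, dif_pos hjk, matUnits_unitAt.ptr_e, smul_mul_assoc, one_mul, mul_smul_comm,
      map_smul, ih (by omega), smul_smul, Fin.prod_univ_castSucc, mul_comm]
    rfl

lemma multiTr_eq_qTrace (D : Matrix (Fin n) (Fin n) K) {m : ℕ} (Z : MatT m n S) :
    multiTr (chainTr D m S) 0 m Z = diagonal fun _ => qTrace D Z := by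
  have h1 : ∀ (A B : Fin m → Fin n) (s : S),
      multiTr (chainTr D m S) 0 m (prodFrom (unitSeq S A B) 0 m * diagonal fun _ => s)
        = (∏ c, D (B c) (A c)) • (diagonal fun _ => s : MatT m n S) := by
    intro A B s
    have := multiTr_unitSeq D A B s 0 m (by omega)
    simpa only [zero_add] using this
  conv_lhs => rw [eq_sum_unitSeq Z]
  simp only [map_sum, h1, qTrace]
  rw [Finset.sum_comm]
  ext I J
  simp only [Matrix.sum_apply, Matrix.smul_apply, Matrix.diagonal_apply]
  split_ifs <;> simp

lemma multiTr_eq_qTraceTail (D : Matrix (Fin n) (Fin n) K) {p : ℕ} (Z : MatT (p + 1) n S) :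
    multiTr (chainTr D (p + 1) S) 1 p Z = leg1 0 (qTraceTail D Z) := by
  have h1 : ∀ (A B : Fin (p + 1) → Fin n) (s : S),
      multiTr (chainTr D (p + 1) S) 1 p (prodFrom (unitSeq S A B) 0 (p + 1) * diagonal fun _ => s)
        = leg1 0 (Matrix.single (A 0) (B 0) ((∏ c : Fin p, D (B c.succ) (A c.succ)) • s)) := by
    intro A B s
    have hmem : ∀ a (ha : a < p + 1), 1 ≤ a →
        unitAt (p + 1) n S 0 (A 0) (B 0) ∈ trivAt K (unitAt (p + 1) n S) ⟨a, ha⟩ :=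
      fun a ha h1 => matUnits_unitAt.e_mem_trivAt (fun e => by
        have := congrArg Fin.val e
        simp only [Fin.val_zero] at this
        omega) _ _
    have hleft : ∀ (k : ℕ) (_ : 1 + k ≤ p + 1) (x : MatT (p + 1) n S),
        multiTr (chainTr D (p + 1) S) 1 k (unitAt (p + 1) n S 0 (A 0) (B 0) * x)
          = unitAt (p + 1) n S 0 (A 0) (B 0) * multiTr (chainTr D (p + 1) S) 1 k x := by
      intro k
      induction k with
      | zero => intro _ _; rfl
      | succ k ih =>
        intro hk x
        rw [multiTr_succ_apply, multiTr_succ_apply, chainTr_of_lt D (by omega),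
          MatUnits.ptr_mul_left D (hmem _ _ (by omega)), ih (by omega)]
    have h0 : prodFrom (unitSeq S A B) 0 1 = unitAt (p + 1) n S 0 (A 0) (B 0) := by
      rw [prodFrom_succ, prodFrom_zero, one_mul, unitSeq, dif_pos (by omega)]
      rfl
    have hsplit := prodFrom_add (unitSeq S A B) 0 1 p
    rw [add_comm 1 p, zero_add, h0] at hsplit
    rw [hsplit, mul_assoc, hleft p (by omega), multiTr_unitSeq D A B s 1 p (by omega), mul_smul_comm,
      unitAt_mul_diagonal, ← leg1_smul, Matrix.smul_single]
    simp only [add_comm 1]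
    rfl
  conv_lhs => rw [eq_sum_unitSeq Z]
  simp only [map_sum, h1, ← leg1_sum]
  congr 1
  ext a b
  simp only [Matrix.sum_apply, Matrix.single_apply, qTraceTail, Matrix.of_apply]
  -- Each multi-index splits into its untraced first entry, pinned to `a` or `b`, and the tail that
  -- is summed over.
  rw [← (Fin.consEquiv fun _ : Fin (p + 1) => Fin n).sum_comp, Fintype.sum_prod_type]
  rw [Finset.sum_eq_single a]
  · rw [Finset.sum_comm]
    rw [← (Fin.consEquiv fun _ : Fin (p + 1) => Fin n).sum_comp, Fintype.sum_prod_type]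
    rw [Finset.sum_eq_single b]
    · simp [Fin.consEquiv]
      rfl
    · intro x _ hx
      simp [Fin.consEquiv, hx]
    · simp
  · intro x _ hx
    simp [Fin.consEquiv, hx]
  · simp

end Traces

/-! ### From chain identities to the powers and symmetric functions of `M`. -/

section Transport

variable {K : Type*} [Field K] {n : ℕ} {S : Type*} [Ring S] [Algebra K S]

/-- The inclusion of the operators on the first `m` factors. -/
def embedFirst (K : Type*) [Field K] (n : ℕ) (S : Type*) [Ring S] [Algebra K S] {m N : ℕ}
    (h : m ≤ N) : MatT m n S →ₐ[K] MatT N n S :=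
  embed K n S (Fin.castLE h) (Fin.castLE_injective h)

lemma embedFirst_adj {m N : ℕ} (h : m ≤ N) (X : Mat2 n K) {i : ℕ} (hi : i + 1 < m) :
    embedFirst K n S h (num S (adj m X i)) = num S (adj N X i) := by
  rw [adj_of_lt X hi, adj_of_lt X (show i + 1 < N by omega), embedFirst, embed_num_leg2]
  · rfl
  · simp

lemma embedFirst_copy {k p : ℕ} (h : k + 1 ≤ p + 1) (Y : Mat2 n K) (M : Matrix (Fin n) (Fin n) S) :
    ∀ i, i < k + 1 → embedFirst K n S h (copy Y M k i) = copy Y M p i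
  | 0, _ => embed_leg1 _ _ _ _
  | i + 1, hi => by
    rw [copy, copy, map_mul, map_mul, embedFirst_copy h Y M i (by omega), embedFirst_adj h Y hi,
      embedFirst_adj h Y⁻¹ hi]

lemma embedFirst_copyProd {k p : ℕ} (h : k + 1 ≤ p + 1) (Y : Mat2 n K)
    (M : Matrix (Fin n) (Fin n) S) :
    embedFirst K n S h (copyProd Y M k) = prodFrom (copy Y M p) 0 (k + 1) := by
  rw [copyProd, map_list_prod, List.map_map, prodFrom]
  congr 1
  refine List.map_congr_left fun i hi => ?_
  rw [Function.comp_apply, embedFirst_copy h Y M i (List.mem_range.mp hi), zero_add]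

/-- Each power and each symmetric function is defined on its own number of factors; this allows all
of them to be compared in one tensor power. -/
lemma embedFirst_multiTr (D : Matrix (Fin n) (Fin n) K) {m N : ℕ} (h : m ≤ N) (j k : ℕ)
    (hk : j + k ≤ m) (Z : MatT m n S) :
    embedFirst K n S h (multiTr (chainTr D m S) j k Z)
      = multiTr (chainTr D N S) j k (embedFirst K n S h Z) := by
  induction k generalizing Z with
  | zero => rfl
  | succ k ih =>
    rw [multiTr_succ_apply, ih (by omega), multiTr_succ_apply, chainTr_of_lt D (by omega),
      chainTr_of_lt D (by omega), embedFirst, map_ptr _ (embed_unitAt _ _)]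
    rfl

lemma qAntisym_eq (q : K) (X : Mat2 n K) (m : ℕ) :
    ∀ k, qAntisym q X m k = antisym q (adj m X) k
  | 0 => rfl
  | 1 => rfl
  | k + 2 => by rw [qAntisym, antisym, qAntisym_eq q X m (k + 1)]

lemma embedFirst_qAntisym (q : K) (X : Mat2 n K) {m N : ℕ} (h : m ≤ N) :
    embedFirst K n S h (num S (qAntisym q X m m))
      = antisym q (fun i => num S (adj N X i)) m := by
  rw [qAntisym_eq, num_eq_map, antisym_map (T' := fun i => num S (adj m X i)) _ q m
    fun i _ => (num_eq_map S _).symm]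
  exact antisym_map _ q m fun i hi => embedFirst_adj h X hi

lemma embedFirst_adjProd (X : Mat2 n K) {k N : ℕ} (h : k + 1 ≤ N) :
    embedFirst K n S h (num S (adjProd X (k + 1))) = coxeter (fun i => num S (adj N X i)) k := by
  rw [adjProd, num_eq_map, map_list_prod, map_list_prod, List.map_map, List.map_map,
    Nat.add_sub_cancel, coxeter]
  congr 1
  refine List.map_congr_left fun i hi => ?_
  have := List.mem_range.mp hi
  exact embedFirst_adj h X (by omega)

lemma leg1_qTraceTail (D : Matrix (Fin n) (Fin n) K) (Y : Mat2 n K)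
    (M : Matrix (Fin n) (Fin n) S) {k p : ℕ} (h : k + 1 ≤ p + 1) (B : MatT (k + 1) n K) :
    leg1 0 (qTraceTail D (num S B * copyProd Y M k))
      = multiTr (chainTr D (p + 1) S) 1 k
        (embedFirst K n S h (num S B) * prodFrom (copy Y M p) 0 (k + 1)) := by
  rw [← embedFirst_copyProd h, ← map_mul, ← embedFirst_multiTr D h 1 k (by omega),
    multiTr_eq_qTraceTail, embedFirst, embed_leg1]
  rfl

lemma diagonal_qTrace (D : Matrix (Fin n) (Fin n) K) (Y : Mat2 n K)
    (M : Matrix (Fin n) (Fin n) S) {k p : ℕ} (h : k + 1 ≤ p + 1) (B : MatT (k + 1) n K) :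
    (diagonal fun _ => qTrace D (num S B * copyProd Y M k))
      = multiTr (chainTr D (p + 1) S) 0 (k + 1)
        (embedFirst K n S h (num S B) * prodFrom (copy Y M p) 0 (k + 1)) := by
  rw [← embedFirst_copyProd h, ← map_mul, ← embedFirst_multiTr D h 0 (k + 1) (by omega),
    multiTr_eq_qTrace, embedFirst, embed_diagonal]

lemma diagonal_sigma (q : K) (D : Matrix (Fin n) (Fin n) K) (X Y : Mat2 n K)
    (M : Matrix (Fin n) (Fin n) S) {p : ℕ} :
    ∀ k, k ≤ p + 1 → (diagonal fun _ => sigma q D X Y M k : MatT (p + 1) n S)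
      = q ^ k • multiTr (chainTr D (p + 1) S) 0 k
        (antisym q (fun i => num S (adj (p + 1) X i)) k * prodFrom (copy Y M p) 0 k)
  | 0, _ => by simp [sigma, multiTr, antisym, prodFrom_zero]
  | k + 1, h => by
    rw [← embedFirst_qAntisym q X h, ← diagonal_qTrace D Y M h]
    ext I J
    simp only [sigma, Matrix.smul_apply, Matrix.diagonal_apply]
    split_ifs <;> simp

lemma leg1_wedgePow (q : K) (D : Matrix (Fin n) (Fin n) K) (X Y : Mat2 n K)
    (M : Matrix (Fin n) (Fin n) S) (p : ℕ) :
    leg1 0 (wedgePow q D X Y M (p + 1)) = multiTr (chainTr D (p + 1) S) 1 p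
        (antisym q (fun i => num S (adj (p + 1) X i)) (p + 1)
          * prodFrom (copy Y M p) 0 (p + 1)) := by
  rw [wedgePow, leg1_qTraceTail D Y M le_rfl, embedFirst_qAntisym]

lemma leg1_qPow (D : Matrix (Fin n) (Fin n) K) (X Y : Mat2 n K)
    (M : Matrix (Fin n) (Fin n) S) {k p : ℕ} (h : k + 1 ≤ p + 1) :
    leg1 0 (qPow D X Y M (k + 1)) = multiTr (chainTr D (p + 1) S) 1 k
        (coxeter (fun i => num S (adj (p + 1) X i)) k
          * prodFrom (copy Y M p) 0 (k + 1)) := by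
  rw [qPow, leg1_qTraceTail D Y M h, embedFirst_adjProd]

lemma neg_one_pow_mul_apply {ι : Type*} [Fintype ι] [DecidableEq ι] (e : ℕ) (Z : Matrix ι ι S)
    (i j : ι) : ((-1) ^ e * Z) i j = (-1) ^ e * Z i j := by
  rcases Nat.even_or_odd e with h' | h' <;> simp [h'.neg_one_pow]

/-- The Cayley–Hamilton–Newton identities for wedge powers. -/
theorem wedgePow_newton {q : K} (hq : Generic q) {X X' Y Ψ : Mat2 n K}
    {D : Matrix (Fin n) (Fin n) K} (h : BraidData q X X' Y Y⁻¹ Ψ D)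
    {M : Matrix (Fin n) (Fin n) S}
    (hM : (num S (leg2 0 1 X) * quad Y M : MatT 2 n S) = quad Y M * num S (leg2 0 1 X))
    (i : ℕ) (hi : 1 ≤ i) (a b : Fin n) :
    qInt q i • wedgePow q D X Y M i a b
      = ∑ k ∈ Finset.range i,
          (-1) ^ (i - k + 1) * (qPow D X Y M (i - k) a b * sigma q D X Y M k) := by
  obtain ⟨p, rfl⟩ : ∃ p, i = p + 1 := ⟨i - 1, by omega⟩
  have key := (qChain h hM p).multiTr_newton hq p le_rfl
  rw [← leg1_wedgePow] at key
  have hs : ∀ k ∈ Finset.range (p + 1), (-1) ^ (p + 1 - k + 1) *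
      (multiTr (chainTr D (p + 1) S) 1 (p - k) (coxeter (fun i => num S (adj (p + 1) X i)) (p - k)
        * prodFrom (copy Y M p) 0 (p - k + 1))
      * (q ^ k • multiTr (chainTr D (p + 1) S) 0 k
        (antisym q (fun i => num S (adj (p + 1) X i)) k * prodFrom (copy Y M p) 0 k)))
      = (-1) ^ (p + 1 - k + 1) * (leg1 0 (qPow D X Y M (p + 1 - k))
        * (diagonal fun _ => sigma q D X Y M k : MatT (p + 1) n S)) := by
    intro k hk
    rw [Finset.mem_range] at hk
    rw [diagonal_sigma q D X Y M k (by omega), show p + 1 - k = (p - k) + 1 by omega,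
      leg1_qPow D X Y M (show p - k + 1 ≤ p + 1 by omega)]
  rw [Finset.sum_congr rfl hs] at key
  -- The `(a, b)` entry is read off at row `(a, a, …, a)` and column `(b, a, …, a)`.
  have e1 : ∀ Z : Matrix (Fin n) (Fin n) S,
      (leg1 0 Z : MatT (p + 1) n S) (fun _ => a) (Function.update (fun _ => a) 0 b) = Z a b := by
    intro Z
    simp only [leg1, Matrix.of_apply, Function.update_self]
    rw [if_pos]
    intro c hc
    rw [Function.update_of_ne hc]
  have := congrFun (congrFun key fun _ => a) (Function.update (fun _ => a) 0 b)
  simpa only [Matrix.smul_apply, Matrix.sum_apply, neg_one_pow_mul_apply, Matrix.mul_diagonal, e1]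
    using this

/-- The symmetric functions for two values of the parameter commute. -/
theorem sigma_commute {q : K} {X X' Y Ψ : Mat2 n K}
    {D : Matrix (Fin n) (Fin n) K} (h : BraidData q X X' Y Y⁻¹ Ψ D)
    {M : Matrix (Fin n) (Fin n) S}
    (hM : (num S (leg2 0 1 X) * quad Y M : MatT 2 n S) = quad Y M * num S (leg2 0 1 X))
    (q₁ q₂ : K) (k l : ℕ) :
    Commute (sigma q₁ D X Y M k) (sigma q₂ D X Y M l) := by
  -- For `n = 0` the operator matrices have no entries from which the scalars could be recovered,
  -- but every `sigma` is then `0` or `1`.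
  rcases Nat.eq_zero_or_pos n with rfl | hn
  · have : ∀ (r : K) (k : ℕ), sigma r D X Y M k = 0 ∨ sigma r D X Y M k = 1 := by
      rintro r (_ | k)
      · exact Or.inr rfl
      · exact Or.inl (by simp [sigma, qTrace])
    rcases this q₁ k with h1 | h1 <;> rw [h1]
    · exact Commute.zero_left _
    · exact Commute.one_left _
  have hc := (qChain h hM (k + l)).multiTr_antisym_commute q₁ q₂ k l (by omega)
  have hc2 := (hc.smul_left (q₁ ^ k)).smul_right (q₂ ^ l)
  rw [← diagonal_sigma q₁ D X Y M k (by omega), ← diagonal_sigma q₂ D X Y M l (by omega)] at hc2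
  have := congrFun (congrFun hc2.eq fun _ => ⟨0, hn⟩) fun _ => ⟨0, hn⟩
  simp only [Matrix.diagonal_mul_diagonal, Matrix.diagonal_apply_eq] at this
  exact this

end Transport

/-! ### Symmetric powers by the substitution `q ↦ -q⁻¹`. -/

section Symmetric

variable {K : Type*} [Field K] {n : ℕ} {S : Type*} [Ring S] [Algebra K S]

lemma Generic.neg_inv {q : K} (hq : Generic q) : Generic (-q⁻¹) where
  ne_zero := neg_ne_zero.mpr (inv_ne_zero hq.ne_zero)
  pow_ne_one m hm h := by
    apply hq.pow_ne_one (m * 2) (by omega)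
    have h2 : (-q⁻¹) ^ (m * 2) = 1 := by rw [pow_mul, h, one_pow]
    rwa [mul_comm m 2, pow_mul, neg_sq, ← pow_mul, inv_pow, inv_eq_one, mul_comm 2 m] at h2

lemma qInt_neg_inv (q : K) (k : ℕ) : qInt (-q⁻¹) (k + 1) = (-1) ^ k * qInt q (k + 1) := by
  have h1 : (-q⁻¹)⁻¹ = -q := by rw [inv_neg, inv_inv]
  rw [qInt, qInt, h1, neg_pow q⁻¹, neg_pow q, ← mul_div_assoc, pow_succ (-1 : K)]
  congr 1 <;> ring

/-- Under the substitution the prefactor and the middle bracket both acquire the sign `(-1) ^ (k +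
1)`, and the two signs cancel. -/
lemma qSym_eq {q : K} (X : Mat2 n K) (m : ℕ) :
    ∀ k, qSym q X m k = qAntisym (-q⁻¹) X m k
  | 0 => rfl
  | 1 => rfl
  | k + 2 => by
    have hs : ((-1 : K) ^ k) * (-1) ^ k = 1 := by rw [← mul_pow]; simp
    have hi : ((-1 : K) ^ k)⁻¹ = (-1) ^ k := inv_eq_of_mul_eq_one_left hs
    have e : (-q⁻¹) ^ (k + 1) • (1 : MatT m n K) - qInt (-q⁻¹) (k + 1) • adj m X k
        = -((-1 : K) ^ k • (q⁻¹ ^ (k + 1) • 1 + qInt q (k + 1) • adj m X k)) := by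
      rw [neg_pow, qInt_neg_inv, pow_succ (-1 : K) k]
      match_scalars <;> ring
    rw [qSym, qAntisym, ← qSym_eq X m (k + 1), e, qInt_neg_inv, mul_inv,
      pow_succ (-1 : K), mul_inv, hi]
    simp only [mul_neg, neg_mul, mul_smul_comm, smul_mul_assoc, smul_neg, smul_smul, inv_neg,
      inv_one, mul_one, neg_smul, neg_neg]
    congr 1
    linear_combination (-(qInt q (k + 2))⁻¹) * hs

lemma tau_eq {q : K} (D : Matrix (Fin n) (Fin n) K) (X Y : Mat2 n K)
    (M : Matrix (Fin n) (Fin n) S) (k : ℕ) :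
    tau q D X Y M k = (-1 : K) ^ k • sigma (-q⁻¹) D X Y M k := by
  rcases k with _ | k
  · simp [tau, sigma]
  · rw [tau, sigma, qSym_eq, smul_smul, ← mul_pow]
    simp

lemma symPow_eq {q : K} (D : Matrix (Fin n) (Fin n) K) (X Y : Mat2 n K)
    (M : Matrix (Fin n) (Fin n) S) (k : ℕ) :
    symPow q D X Y M k = wedgePow (-q⁻¹) D X Y M k := by
  rcases k with _ | k
  · rfl
  · rw [symPow, wedgePow, qSym_eq]

/-- The parameter enters only through `q - q⁻¹`, which the substitution fixes. -/
lemma BraidData.neg_inv {q : K} {X X' Y Y' Ψ : Mat2 n K} {D : Matrix (Fin n) (Fin n) K}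
    (h : BraidData q X X' Y Y' Ψ D) : BraidData (-q⁻¹) X X' Y Y' Ψ D :=
  { h with
    hecke := by
      rw [h.hecke, inv_neg, inv_inv]
      congr 2
      ring }

/-- The Cayley–Hamilton–Newton identities for symmetric powers. -/
theorem symPow_newton {q : K} (hq : Generic q) {X X' Y Ψ : Mat2 n K}
    {D : Matrix (Fin n) (Fin n) K} (h : BraidData q X X' Y Y⁻¹ Ψ D)
    {M : Matrix (Fin n) (Fin n) S}
    (hM : (num S (leg2 0 1 X) * quad Y M : MatT 2 n S) = quad Y M * num S (leg2 0 1 X))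
    (i : ℕ) (hi : 1 ≤ i) (a b : Fin n) :
    qInt q i • symPow q D X Y M i a b
      = ∑ k ∈ Finset.range i, qPow D X Y M (i - k) a b * tau q D X Y M k := by
  obtain ⟨p, rfl⟩ : ∃ p, i = p + 1 := ⟨i - 1, by omega⟩
  have key := wedgePow_newton hq.neg_inv h.neg_inv hM (p + 1) hi a b
  have hs : ((-1 : K) ^ p) * (-1) ^ p = 1 := by rw [← mul_pow]; simp
  -- Clears the sign of `qInt (-q⁻¹) (p + 1)`; what is left of the alternating sign is `(-1) ^ k`,
  -- the one relating `tau` to `sigma`.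
  have key2 := congrArg (((-1 : K) ^ p) • ·) key
  simp only [qInt_neg_inv, smul_smul, ← mul_assoc, hs, one_mul] at key2
  rw [symPow_eq, key2, Finset.smul_sum]
  refine Finset.sum_congr rfl fun k hk => ?_
  rw [Finset.mem_range] at hk
  rw [tau_eq, mul_smul_comm]
  obtain ⟨m, rfl⟩ : ∃ m, p = m + k := ⟨p - k, by omega⟩
  rw [show m + k + 1 - k + 1 = m + 2 by omega]
  have e : ∀ (r : ℕ) (x : S), (-1) ^ r * x = (-1 : K) ^ r • x := fun r x => by
    rcases Nat.even_or_odd r with h' | h' <;> simp [h'.neg_one_pow]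
  rw [mul_assoc, e, smul_smul]
  congr 1
  have hm : ((-1 : K) ^ m) * (-1) ^ m = 1 := by rw [← mul_pow]; simp
  rw [pow_add, pow_add]
  linear_combination ((-1 : K) ^ k) * hm

end Symmetric

/-- The entrywise relations of the quotient, reassembled into the single matrix identity that the
chain axioms need. -/
lemma gen_relation {K : Type*} [Field K] {n : ℕ} (X Y : Mat2 n K) :
    (num (QMAlg X Y) (leg2 0 1 X) * quad Y (gen X Y) : MatT 2 n (QMAlg X Y))
      = quad Y (gen X Y) * num (QMAlg X Y) (leg2 0 1 X) := by
  set π := RingQuot.mkAlgHom K (Rel X Y)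
  have hnum : ∀ Z : MatT 2 n K,
      π.mapMatrix (num (FreeAlgebra K (Fin n × Fin n)) Z) = num (QMAlg X Y) Z := by
    intro Z
    ext I J
    simp only [num, AlgHom.mapMatrix_apply, Matrix.map_apply]
    exact π.commutes _
  have hleg : π.mapMatrix (leg1 0 (freeGen n K) : MatT 2 n _) = leg1 0 (gen X Y) := by
    ext I J
    simp only [AlgHom.mapMatrix_apply, Matrix.map_apply, leg1, Matrix.of_apply]
    split_ifs
    · rfl
    · exact map_zero π
  have hquad : π.mapMatrix (quad Y (freeGen n K)) = quad Y (gen X Y) := by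
    rw [quad, quad, map_mul, map_mul, map_mul, hnum, hnum, hleg]
  rw [← hquad, ← hnum, ← map_mul, ← map_mul]
  ext I J
  exact RingQuot.mkAlgHom_rel K (Rel.entry I J)

end QMatrix

end

/-! ### The theorem for the quantum matrix algebra. -/

open QMatrix in
theorem mainTheorem1 {K : Type*} [Field K] (n : ℕ) (q : K)
    (hq0 : q ≠ 0) (hq : ∀ m : ℕ, 0 < m → q ^ m ≠ 1)
    (R F : Mat2 n K) (hRF : Compatible R F) (hF : IsUnit F)
    (hHecke : hat R * hat R = (q - q⁻¹) • hat R + 1)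
    (Ψ : Mat2 n K) (hΨ : IsSkewInverse (hat R) Ψ)
    (D : Matrix (Fin n) (Fin n) K) (hD : D = traceSnd Ψ)
    (M : Matrix (Fin n) (Fin n) (QMAlg (hat R) (hat F))) (hM : M = gen (hat R) (hat F))
    (σ τ : ℕ → QMAlg (hat R) (hat F))
    (hσ : σ = sigma q D (hat R) (hat F) M) (hτ : τ = tau q D (hat R) (hat F) M) :
    (∀ i : ℕ, 1 ≤ i → ∀ a b : Fin n,
      qInt q i • wedgePow q D (hat R) (hat F) M i a b
        = ∑ k ∈ Finset.range i,
            (-1) ^ (i - k + 1) * (qPow D (hat R) (hat F) M (i - k) a b * σ k)) ∧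
    (∀ i : ℕ, 1 ≤ i → ∀ a b : Fin n,
      qInt q i • symPow q D (hat R) (hat F) M i a b
        = ∑ k ∈ Finset.range i, qPow D (hat R) (hat F) M (i - k) a b * τ k) ∧
    (∀ x ∈ Algebra.adjoin K (Set.range σ ∪ Set.range τ),
      ∀ y ∈ Algebra.adjoin K (Set.range σ ∪ Set.range τ), x * y = y * x) := by
  subst hD hM hσ hτ
  have hB := hRF.braidData hF hHecke hΨ
  have hrel := gen_relation (hat R) (hat F)
  have hg : Generic q := ⟨hq0, hq⟩
  refine ⟨wedgePow_newton hg hB hrel, symPow_newton hg hB hrel, fun x hx y hy => ?_⟩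
  -- Every generator is a scalar multiple of a `sigma` with parameter `q` or `-q⁻¹`, so
  -- `sigma_commute` covers all pairs.
  have hc : ∀ u ∈ Set.range (sigma q (traceSnd Ψ) (hat R) (hat F) (gen (hat R) (hat F)))
        ∪ Set.range (tau q (traceSnd Ψ) (hat R) (hat F) (gen (hat R) (hat F))),
      ∃ (c r : K) (k : ℕ),
        u = c • sigma r (traceSnd Ψ) (hat R) (hat F) (gen (hat R) (hat F)) k := by
    rintro u (⟨k, rfl⟩ | ⟨k, rfl⟩)
    · exact ⟨1, q, k, (one_smul _ _).symm⟩
    · exact ⟨(-1) ^ k, -q⁻¹, k, tau_eq _ _ _ _ _⟩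
  refine (Algebra.commute_of_mem_adjoin_of_forall_mem_commute hy fun v hv => ?_).eq
  refine (Algebra.commute_of_mem_adjoin_of_forall_mem_commute hx fun u hu => ?_).symm
  obtain ⟨c, r, k, rfl⟩ := hc u hu
  obtain ⟨c', r', l, rfl⟩ := hc v hv
  exact ((sigma_commute hB hrel r' r l k).smul_left c').smul_right c
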